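/- Let $F$ be an algebraically closed field, let $n\ge 1$, and let $B\in M_n(F)$ be a nilpotent matrix. Let $\mathcal N_B$ be the set of all nilpotent $A\in M_n(F)$ with $AB=BA$, with the Zariski topology. For $A\in\mathcal N_B$ let $\mathcal A(A,B)$ be the unital subalgebra of $M_n(F)$ generated by $A$ and $B$, and $\mathcal A(A^T,B^T)$ the one generated by the transposes; a vector $v\in F^n$ is cyclic for a subalgebra $\mathcal R\subseteq M_n(F)$ if $\mathcal R v=F^n$. Let $U_B$ be the set of all $(A,v,w)\in\mathcal N_B\times F^n\times F^n$ such that $v$ is cyclic for $\mathcal A(A,B)$ and $w$ is cyclic for $\mathcal A(A^T,B^T)$, and let $\pi_B:\mathcal N_B\times F^n\times F^n\to\mathcal N_B$ be the projection. An artinian local ring is called Gorenstein if its socle (the annihilator of its maximal ideal) is a simple module, and a complete intersection if it is isomorphic to the quotient of a regular local ring by an ideal generated by a regular sequence. Then: 1. $\pi_B(U_B)$ is dense in $\mathcal N_B$. 2. For every $A\in\mathcal N_B$ the following are equivalent: (a) $A\in\pi_B(U_B)$; (b) $\mathcal A(A,B)$ is a Gorenstein artinian local ring and $\dim_F\mathcal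 A(A,B)=n$; (c) both $\mathcal A(A,B)$ and $\mathcal A(A^T,B^T)$ have a cyclic vector. If these hold, then $\mathcal A(A,B)$ is a complete intersection. 3. For a generic $A\in\mathcal N_B$, that is, for every $A$ in some dense Zariski-open subset of $\mathcal N_B$, the algebra $\mathcal A(A,B)$ is Gorenstein of dimension $n$ and a complete intersection. -/

import Mathlib

universe u

/-- The nilpotent commutator `N_B` of `B`: the set of all nilpotent `n × n` matrices `A` with
`A B = B A`. -/
def nilpotentCommutator {F : Type u} [Field F] {n : ℕ} (B : Matrix (Fin n) (Fin n) F) :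
    Set (Matrix (Fin n) (Fin n) F) :=
  {A | IsNilpotent A ∧ A * B = B * A}

/-- The Zariski topology on the affine space of `n × n` matrices over `F`: its basic open sets are
the non-vanishing loci of polynomials in the `n²` matrix entries. -/
@[reducible]
def matrixZariskiTopology (F : Type u) [Field F] (n : ℕ) :
    TopologicalSpace (Matrix (Fin n) (Fin n) F) :=
  TopologicalSpace.generateFrom
    {U | ∃ p : MvPolynomial (Fin n × Fin n) F,
      U = {A | MvPolynomial.eval (fun ij : Fin n × Fin n => A ij.1 ij.2) p ≠ 0}}

/-- `N_B` carries the Zariski topology, as a subspace of the affine space of matrices. -/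
instance nilpotentCommutator.zariskiTopology {F : Type u} [Field F] {n : ℕ}
    (B : Matrix (Fin n) (Fin n) F) : TopologicalSpace (nilpotentCommutator B) :=
  (matrixZariskiTopology F n).induced Subtype.val

/-- A property holds for a generic point of `X` if it holds at every point of some dense open
subset of `X`. -/
def HoldsGenerically {X : Type u} [TopologicalSpace X] (P : X → Prop) : Prop :=
  ∃ W : Set X, IsOpen W ∧ Dense W ∧ ∀ x ∈ W, P x

/-- The unital subalgebra of `M_n(F)` generated by `A` and `B`. -/
def pairAlgebra {F : Type u} [Field F] {n : ℕ} (A B : Matrix (Fin n) (Fin n) F) :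
    Subalgebra F (Matrix (Fin n) (Fin n) F) :=
  Algebra.adjoin F {A, B}

/-- For `A ∈ N_B` the algebra generated by `A` and `B` is commutative. -/
theorem pairAlgebra.isMulCommutative {F : Type u} [Field F] {n : ℕ}
    (B : Matrix (Fin n) (Fin n) F) (A : nilpotentCommutator B) :
    IsMulCommutative (pairAlgebra A.1 B) := by
  refine Algebra.isMulCommutative_adjoin F ?_
  rintro x (rfl | rfl) y (rfl | rfl)
  · rfl
  · exact A.2.2
  · exact A.2.2.symm
  · rfl

/-- For `A ∈ N_B` the algebra generated by `A` and `B`, with its usual operations, is a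
commutative ring. -/
instance pairAlgebra.commRing {F : Type u} [Field F] {n : ℕ}
    (B : Matrix (Fin n) (Fin n) F) (A : nilpotentCommutator B) :
    CommRing (pairAlgebra A.1 B) :=
  { (pairAlgebra A.1 B).toRing with
    mul_comm := (pairAlgebra.isMulCommutative B A).is_comm.comm }

/-- `v` is a cyclic vector for the subalgebra `R` of `M_n(F)`: `R v = F^n`. -/
def IsCyclicVector {F : Type u} [Field F] {n : ℕ}
    (R : Subalgebra F (Matrix (Fin n) (Fin n) F)) (v : Fin n → F) : Prop :=
  ∀ u : Fin n → F, ∃ X ∈ R, X.mulVec v = u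

/-- The set `U_B` of all triples `(A, v, w)` in `N_B × F^n × F^n` such that `v` is a cyclic vector
for `(A, B)` and `w` is a cyclic vector for `(Aᵀ, Bᵀ)`. -/
def cyclicCocyclicTriples {F : Type u} [Field F] {n : ℕ} (B : Matrix (Fin n) (Fin n) F) :
    Set (nilpotentCommutator B × (Fin n → F) × (Fin n → F)) :=
  {t | IsCyclicVector (pairAlgebra t.1.1 B) t.2.1 ∧
    IsCyclicVector (pairAlgebra t.1.1.transpose B.transpose) t.2.2}

/-- The projection to `N_B` of the set `U_B`. -/
def cyclicCocyclicLocus {F : Type u} [Field F] {n : ℕ} (B : Matrix (Fin n) (Fin n) F) :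
    Set (nilpotentCommutator B) :=
  Prod.fst '' cyclicCocyclicTriples B

/-- The socle `(0 : m)` of a local ring: the annihilator of its maximal ideal. -/
noncomputable def localSocle (R : Type u) [CommRing R] [IsLocalRing R] : Ideal R :=
  (IsLocalRing.maximalIdeal R).annihilator

/-- A local artinian ring is Gorenstein if its socle is a simple module. -/
def IsArtinianGorenstein (R : Type u) [CommRing R] : Prop :=
  IsArtinianRing R ∧ ∃ _ : IsLocalRing R, IsSimpleModule R (localSocle R)

/-- A local artinian ring is a complete intersection if it is the quotient of a regular local ring
by an ideal generated by a regular sequence. (An artinian local ring is complete, so this is the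
usual definition, in which such a presentation is required of the completion.) -/
def IsArtinianCompleteIntersection (R : Type u) [CommRing R] : Prop :=
  IsArtinianRing R ∧ IsLocalRing R ∧
    ∃ (S : Type u) (_ : CommRing S) (_ : IsRegularLocalRing S) (rs : List S),
      RingTheory.Sequence.IsRegular S rs ∧ Nonempty (R ≃+* S ⧸ Ideal.ofList rs)

/-! Density is linear algebra. Given `A` in the nilpotent commutator, `exists_isAdaptedChain`
produces Jordan block generators `e k` of `B` and a flag `W` with `A (e k) ∈ W k`. The endomorphisms
`T` commuting with `B` with all `T (e k) ∈ W k` form a linear space of nilpotents that contains `A`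
and two shifts along the blocks, one cyclic and one cocyclic together with `B`
(`exists_cyclic_cocyclic`). Both conditions are open, and nonempty open subsets of a line over an
infinite field meet. Joining the two shifts, and then `A` to a point good for both, gives good
points in every neighbourhood of `A`; irreducibility of the nilpotent commutator is not needed.

The algebra `R` generated by `A` and `B` is local with maximal ideal `(A, B)` and residue field `F`.
If `v` and `w` are cyclic, then `r ↦ r v` identifies `R` with `F^n`, and `r ↦ w ⬝ r v` is injective
on the socle, which is therefore a line. Conversely, in a Gorenstein `R` every nonzero element
divides a socle generator `s`, so evaluation at any `v` with `s v ≠ 0` is injective, hence bijective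
in dimension `n`; the same works for transposes.

For the complete intersection property, let `S` be the local ring of the plane at the origin,
mapping onto `R`. The Koszul complex of `(A, B)` on `R` has Euler characteristic zero, and its outer
homologies, the residue field and the socle, are lines. So the middle one has dimension at most two,
and by Nakayama the kernel of `S → R` has two generators (`exists_ker_eq_span_pair`). These have no
common prime factor, so they form a regular sequence in the factorial ring `S` (`isRegular_pair`).
-/

/-! ### Jordan bases adapted to a commuting nilpotent endomorphism -/

section AdaptedChain

open Module

variable {F V : Type*} [Field F] [AddCommGroup V] [Module F V]

/-- A flag of subspaces from the range of a nilpotent endomorphism `x` to the whole space, together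
with vectors `e k` completing each step, such that the `e k` are generators of the Jordan blocks of
`x`, of sizes `μ k`. -/
structure IsAdaptedChain (x : End F V) (t : ℕ) (W : ℕ → Submodule F V) (e : ℕ → V) (μ : ℕ → ℕ) :
    Prop where
  zero : W 0 = LinearMap.range x
  succ : ∀ k < t, W (k + 1) = W k ⊔ Submodule.span F {e k}
  top : W t = ⊤
  notMem : ∀ k < t, e k ∉ W k
  pow : ∀ k < t, (x ^ μ k) (e k) = 0
  ker : ∀ k < t, LinearMap.ker (x ^ (μ k - 1)) ≤ W k

/-- Take the least `m` such that `ker (x ^ m)` escapes `W`, and a vector of that kernel outside `W`.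
Its last image under powers of `A` to stay outside `W` serves as `f`; commutation keeps it in the
kernel. -/
theorem exists_adapted_vector {x A : End F V} (hx : IsNilpotent x) (hA : IsNilpotent A)
    (h : Commute A x) {W : Submodule F V} (hW : W ≠ ⊤) :
    ∃ (f : V) (m : ℕ), (x ^ m) f = 0 ∧ LinearMap.ker (x ^ (m - 1)) ≤ W ∧ f ∉ W ∧ A f ∈ W := by
  classical
  have hex : ∃ m, ¬ LinearMap.ker (x ^ m) ≤ W := by
    obtain ⟨N, hN⟩ := hx
    refine ⟨N, fun hle => hW ?_⟩
    rw [hN, LinearMap.ker_zero] at hle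
    exact top_le_iff.1 hle
  obtain ⟨f₀, hf₀, hf₀W⟩ := SetLike.not_le_iff_exists.1 (Nat.find_spec hex)
  have hm0 : Nat.find hex ≠ 0 := by
    intro h0
    have := Nat.find_spec hex
    rw [h0, pow_zero, Module.End.one_eq_id, LinearMap.ker_id] at this
    exact this bot_le
  have hej : ∃ j, (A ^ j) f₀ ∈ W := by
    obtain ⟨N, hN⟩ := hA
    exact ⟨N, by simp [hN]⟩
  have hj0 : Nat.find hej ≠ 0 := by
    intro h0
    have := Nat.find_spec hej
    rw [h0] at this
    exact hf₀W (by simpa using this)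
  refine ⟨(A ^ (Nat.find hej - 1)) f₀, Nat.find hex, ?_, ?_, ?_, ?_⟩
  · rw [← Module.End.mul_apply, ← ((h.pow_pow _ _).eq), Module.End.mul_apply,
      LinearMap.mem_ker.1 hf₀, map_zero]
  · by_contra hc
    exact Nat.find_min hex (Nat.sub_lt (Nat.pos_of_ne_zero hm0) one_pos) hc
  · exact Nat.find_min hej (Nat.sub_lt (Nat.pos_of_ne_zero hj0) one_pos)
  · have := Nat.find_spec hej
    rwa [← Module.End.mul_apply, ← pow_succ', Nat.sub_add_cancel (Nat.pos_of_ne_zero hj0)]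

theorem exists_isAdaptedChain [FiniteDimensional F V] {x A : End F V} (hx : IsNilpotent x)
    (hA : IsNilpotent A) (h : Commute A x) :
    ∃ t W e μ, IsAdaptedChain x t W e μ ∧ ∀ k < t, A (e k) ∈ W k := by
  classical
  -- A dummy value at `⊤` lets the flag be defined by recursion on all of `ℕ`.
  have step : ∀ W : Submodule F V, ∃ (f : V) (m : ℕ), W ≠ ⊤ →
      (x ^ m) f = 0 ∧ LinearMap.ker (x ^ (m - 1)) ≤ W ∧ f ∉ W ∧ A f ∈ W := by
    intro W
    by_cases hW : W ≠ ⊤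
    · obtain ⟨f, m, H⟩ := exists_adapted_vector hx hA h hW
      exact ⟨f, m, fun _ => H⟩
    · exact ⟨0, 0, fun h => absurd h hW⟩
  choose f m hfm using step
  let W : ℕ → Submodule F V :=
    fun k => Nat.rec (LinearMap.range x) (fun _ W => W ⊔ Submodule.span F {f W}) k
  have hW1 : ∀ k, W (k + 1) = W k ⊔ Submodule.span F {f (W k)} := fun k => rfl
  have hex : ∃ t, W t = ⊤ := by
    by_contra! hne
    have hlt : StrictMono W := by
      refine strictMono_nat_of_lt_succ fun k => ?_
      obtain ⟨-, -, h3, -⟩ := hfm (W k) (hne k)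
      rw [hW1]
      refine lt_of_le_of_ne le_sup_left fun heq => h3 ?_
      exact heq.ge (Submodule.mem_sup_right (Submodule.mem_span_singleton_self _))
    obtain ⟨N, hN⟩ := WellFoundedGT.monotone_chain_condition ⟨W, hlt.monotone⟩
    exact absurd (hN (N + 1) (by omega)) (hlt (Nat.lt_succ_self N)).ne
  obtain ⟨t, ht, hmin⟩ : ∃ t, W t = ⊤ ∧ ∀ k < t, W k ≠ ⊤ := by
    classical
    exact ⟨Nat.find hex, Nat.find_spec hex, fun k hk => Nat.find_min hex hk⟩
  have hall := fun k (hk : k < t) => hfm (W k) (hmin k hk)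
  exact ⟨t, W, fun k => f (W k), fun k => m (W k),
    ⟨rfl, fun k _ => hW1 k, ht, fun k hk => (hall k hk).2.2.1,
      fun k hk => (hall k hk).1, fun k hk => (hall k hk).2.1⟩, fun k hk => (hall k hk).2.2.2⟩

namespace IsAdaptedChain

variable {x : End F V} {t : ℕ} {W : ℕ → Submodule F V} {e : ℕ → V} {μ : ℕ → ℕ}

theorem mono (H : IsAdaptedChain x t W e μ) {i j : ℕ} (hij : i ≤ j) (hj : j ≤ t) : W i ≤ W j := by
  induction j, hij using Nat.le_induction with
  | base => exact le_rfl
  | succ j hij ih =>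
    rw [H.succ j hj]
    exact (ih (by omega)).trans le_sup_left

theorem range_le (H : IsAdaptedChain x t W e μ) {k : ℕ} (hk : k ≤ t) : LinearMap.range x ≤ W k :=
  H.zero ▸ H.mono (Nat.zero_le k) hk

theorem mem (H : IsAdaptedChain x t W e μ) {i k : ℕ} (hik : i < k) (hk : k ≤ t) : e i ∈ W k := by
  refine H.mono (Nat.succ_le_of_lt hik) hk ?_
  rw [H.succ i (by omega)]
  exact Submodule.mem_sup_right (Submodule.mem_span_singleton_self _)

theorem size_pos (H : IsAdaptedChain x t W e μ) {k : ℕ} (hk : k < t) : 0 < μ k := by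
  rcases Nat.eq_zero_or_pos (μ k) with h | h
  · have := H.pow k hk
    rw [h, pow_zero, Module.End.one_apply] at this
    exact absurd (this ▸ zero_mem _) (H.notMem k hk)
  · exact h

theorem size_mono (H : IsAdaptedChain x t W e μ) {i k : ℕ} (hik : i ≤ k) (hk : k < t) :
    μ i ≤ μ k := by
  by_contra hlt
  refine H.notMem k hk (H.mono hik hk.le (H.ker i (by omega) ?_))
  rw [LinearMap.mem_ker]
  exact Module.End.pow_map_zero_of_le (by omega) (H.pow k hk)

theorem pow_eq_zero (H : IsAdaptedChain x t W e μ) {k j : ℕ} (hk : k < t) (hj : μ k ≤ j) :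
    (x ^ j) (e k) = 0 :=
  Module.End.pow_map_zero_of_le hj (H.pow k hk)

/-- Factor out `x ^ (μ k₀ - 1)`, with `k₀` the last index among the smallest blocks that occur. The
remaining sum lies in `W k₀` by `ker`, as does each term other than that of `e k₀`: it is an earlier
generator or lies in the range of `x`. -/
theorem top_coeff_eq_zero (H : IsAdaptedChain x t W e μ) (c : Fin t → F)
    (hc : ∑ k, c k • (x ^ (μ k - 1)) (e k) = 0) : c = 0 := by
  classical
  by_contra hne
  have hS : (Finset.univ.filter fun k => c k ≠ 0).Nonempty := by
    obtain ⟨k, hk⟩ := Function.ne_iff.1 hne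
    exact ⟨k, by simpa using hk⟩
  obtain ⟨k₁, hk₁, hmin⟩ := Finset.exists_min_image _ (fun k : Fin t => μ k) hS
  have hS' : (Finset.univ.filter fun k : Fin t => c k ≠ 0 ∧ μ k = μ k₁).Nonempty :=
    ⟨k₁, by simpa using hk₁⟩
  obtain ⟨k₀, hk₀, hmax⟩ := Finset.exists_max_image _ (fun k : Fin t => k) hS'
  simp only [Finset.mem_filter, Finset.mem_univ, true_and, ne_eq] at hmin hk₀ hmax
  have hz : ∑ k, c k • (x ^ (μ k - μ k₀)) (e k) ∈ W k₀ := by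
    refine H.ker k₀ k₀.2 ?_
    rw [LinearMap.mem_ker, ← hc, map_sum]
    refine Finset.sum_congr rfl fun k _ => ?_
    rw [map_smul]
    by_cases hck : c k = 0
    · simp [hck]
    · have h1 := hmin k hck
      have h2 := H.size_pos k₀.2
      rw [← Module.End.mul_apply, ← pow_add]
      congr 4
      omega
  rw [← Finset.add_sum_erase _ _ (Finset.mem_univ k₀)] at hz
  have hrest : ∑ k ∈ Finset.univ.erase k₀, c k • (x ^ (μ k - μ k₀)) (e k) ∈ W k₀ := by
    refine Submodule.sum_mem _ fun k hk => ?_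
    by_cases hck : c k = 0
    · simp [hck]
    · refine Submodule.smul_mem _ _ ?_
      rcases Nat.eq_zero_or_pos (μ k - μ k₀) with h0 | h0
      · have h1 := hmin k hck
        have h2 := hmax k ⟨hck, by omega⟩
        rw [h0, pow_zero, Module.End.one_apply]
        exact H.mem (Fin.lt_def.1 (lt_of_le_of_ne h2 (Finset.ne_of_mem_erase hk))) k₀.2.le
      · refine H.range_le k₀.2.le ⟨(x ^ (μ k - μ k₀ - 1)) (e k), ?_⟩
        rw [← Module.End.mul_apply, ← pow_succ', Nat.sub_add_cancel h0]
  have h3 := (Submodule.add_mem_iff_left _ hrest).1 hz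
  rw [Nat.sub_self, pow_zero, Module.End.one_apply] at h3
  exact H.notMem k₀ k₀.2 ((Submodule.smul_mem_iff _ hk₀.1).1 h3)

/-- Let `r` be the largest distance `μ k - j` over the nonzero coefficients. Then `x ^ (r - 1)`
kills every term except those it sends to block ends, and `top_coeff_eq_zero` applies. -/
theorem linearIndependent (H : IsAdaptedChain x t W e μ) :
    LinearIndependent F (fun p : Σ k : Fin t, Fin (μ k) => (x ^ (p.2 : ℕ)) (e p.1)) := by
  classical
  rw [Fintype.linearIndependent_iff]
  intro c hc
  by_contra! hne
  have hS : (Finset.univ.filter fun p => c p ≠ 0).Nonempty := by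
    obtain ⟨k, hk⟩ := hne
    exact ⟨k, by simpa using hk⟩
  obtain ⟨p₁, hp₁, hmax⟩ := Finset.exists_max_image _
    (fun p : Σ k : Fin t, Fin (μ k) => μ p.1 - (p.2 : ℕ)) hS
  simp only [Finset.mem_filter, Finset.mem_univ, true_and, ne_eq] at hp₁ hmax
  set r := μ p₁.1 - (p₁.2 : ℕ) with hr
  have hr0 : 0 < r := by have := p₁.2.2; omega
  -- For a block shorter than `r`, truncated subtraction would wrongly select the generator, hence
  -- the default `0`.
  let d : Fin t → F := fun k => if hk : μ k - r < μ k then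
    (if r ≤ μ k then c ⟨k, ⟨μ k - r, hk⟩⟩ else 0) else 0
  have hd : d = 0 := by
    refine H.top_coeff_eq_zero d ?_
    have h1 := congrArg (x ^ (r - 1)) hc
    rw [map_zero, map_sum, Fintype.sum_sigma] at h1
    rw [← h1]
    refine Finset.sum_congr rfl fun k _ => ?_
    have hk0 := H.size_pos k.2
    have hlt : μ k - r < μ k := by omega
    by_cases hrk : r ≤ μ k
    · rw [Finset.sum_eq_single ⟨μ k - r, hlt⟩]
      · simp only [d, hlt, hrk, dif_pos, if_pos]
        rw [map_smul, ← Module.End.mul_apply, ← pow_add]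
        congr 4
        omega
      · intro j _ hj
        by_cases hcj : c ⟨k, j⟩ = 0
        · simp [hcj]
        · have h2 := hmax ⟨k, j⟩ hcj
          have h3 : (j : ℕ) ≠ μ k - r := fun h => hj (Fin.ext h)
          simp only at h2 ⊢
          have h4 := j.2
          rw [map_smul, ← Module.End.mul_apply, ← pow_add, H.pow_eq_zero k.2 (by omega), smul_zero]
      · simp
    · rw [Finset.sum_eq_zero]
      · simp [d, hrk]
      · intro j _
        by_cases hcj : c ⟨k, j⟩ = 0
        · simp [hcj]
        · have h2 := hmax ⟨k, j⟩ hcj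
          rw [map_smul, ← Module.End.mul_apply, ← pow_add, H.pow_eq_zero k.2, smul_zero]
          omega
  apply hp₁
  have h4 := congrFun hd p₁.1
  have h5 := p₁.2.2
  have h6 : μ p₁.1 - r = p₁.2 := by omega
  have h7 : r ≤ μ p₁.1 := by omega
  simpa [d, h6, h7, H.size_pos p₁.1.2, hr0] using h4

/-- Nakayama for a nilpotent: `V = U + x V` iterates to `V = U + x ^ N V`. -/
theorem eq_top_of_mem (H : IsAdaptedChain x t W e μ) (hx : IsNilpotent x) {U : Submodule F V}
    (hU : ∀ u ∈ U, x u ∈ U) (he : ∀ k < t, e k ∈ U) : U = ⊤ := by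
  have hWU : ∀ k ≤ t, W k ≤ U ⊔ LinearMap.range x := by
    intro k
    induction k with
    | zero => exact fun _ => H.zero ▸ le_sup_right
    | succ k ih =>
      intro hk
      rw [H.succ k hk]
      refine sup_le (ih (by omega)) ?_
      rw [Submodule.span_singleton_le_iff_mem]
      exact Submodule.mem_sup_left (he k hk)
  have h1 : ∀ v, ∃ u ∈ U, ∃ z, v = u + x z := by
    intro v
    have : v ∈ U ⊔ LinearMap.range x := hWU t le_rfl (H.top ▸ Submodule.mem_top)
    obtain ⟨u, hu, _, ⟨z, rfl⟩, rfl⟩ := Submodule.mem_sup.1 this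
    exact ⟨u, hu, z, rfl⟩
  have h2 : ∀ N v, ∃ u ∈ U, ∃ z, v = u + (x ^ N) z := by
    intro N
    induction N with
    | zero => exact fun v => ⟨0, zero_mem _, v, by simp⟩
    | succ N ih =>
      intro v
      obtain ⟨u, hu, z, rfl⟩ := h1 v
      obtain ⟨u', hu', z', rfl⟩ := ih z
      exact ⟨u + x u', add_mem hu (hU _ hu'), z', by
        rw [map_add, ← add_assoc, pow_succ', Module.End.mul_apply]⟩
  obtain ⟨N, hN⟩ := hx
  refine top_le_iff.1 fun v _ => ?_
  obtain ⟨u, hu, z, rfl⟩ := h2 N v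
  simpa [hN] using hu

/-- The Jordan basis of a nilpotent endomorphism attached to an adapted chain. -/
noncomputable def basis (H : IsAdaptedChain x t W e μ) (hx : IsNilpotent x) :
    Basis (Σ k : Fin t, Fin (μ k)) F V :=
  Basis.mk H.linearIndependent <| by
    refine (H.eq_top_of_mem hx (U := Submodule.span F (Set.range _)) ?_ ?_).ge
    · intro u hu
      induction hu using Submodule.span_induction with
      | mem u hu =>
        obtain ⟨⟨k, j⟩, rfl⟩ := hu
        simp only
        rw [← Module.End.mul_apply, ← pow_succ']
        by_cases hj : (j : ℕ) + 1 < μ k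
        · exact Submodule.subset_span ⟨⟨k, ⟨j + 1, hj⟩⟩, rfl⟩
        · rw [H.pow_eq_zero k.2 (by omega)]
          exact zero_mem _
      | zero => simp
      | add u v _ _ hu hv => rw [map_add]; exact add_mem hu hv
      | smul a u _ hu => rw [map_smul]; exact Submodule.smul_mem _ _ hu
    · exact fun k hk => Submodule.subset_span ⟨⟨⟨k, hk⟩, ⟨0, H.size_pos hk⟩⟩, by simp⟩

theorem basis_apply (H : IsAdaptedChain x t W e μ) (hx : IsNilpotent x) (k : Fin t)
    (j : Fin (μ k)) : H.basis hx ⟨k, j⟩ = (x ^ (j : ℕ)) (e k) := by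
  simp [basis]

/-- As an `F[x]`-module, `V` is the direct sum of the cyclic modules on the `e k`, with annihilators
generated by `x ^ μ k`, so `hg` is the only constraint. -/
theorem exists_commute_apply_eq (H : IsAdaptedChain x t W e μ) (hx : IsNilpotent x)
    (g : Fin t → V) (hg : ∀ k : Fin t, (x ^ μ k) (g k) = 0) :
    ∃ T : End F V, Commute T x ∧ ∀ k : Fin t, T (e k) = g k := by
  let T : End F V := (H.basis hx).constr F fun p => (x ^ (p.2 : ℕ)) (g p.1)
  have hT : ∀ (k : Fin t) (j : ℕ), T ((x ^ j) (e k)) = (x ^ j) (g k) := by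
    intro k j
    by_cases hj : j < μ k
    · rw [show (x ^ j) (e k) = H.basis hx ⟨k, ⟨j, hj⟩⟩ from (H.basis_apply hx k ⟨j, hj⟩).symm,
        Basis.constr_basis]
    · rw [H.pow_eq_zero k.2 (by omega), map_zero,
        Module.End.pow_map_zero_of_le (not_lt.1 hj) (hg k)]
  refine ⟨T, ?_, fun k => by simpa using hT k 0⟩
  refine (H.basis hx).ext fun p => ?_
  obtain ⟨k, j⟩ := p
  rw [H.basis_apply hx, Module.End.mul_apply, Module.End.mul_apply, hT,
    ← Module.End.mul_apply x, ← pow_succ', hT, pow_succ', Module.End.mul_apply]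

/-- `T` is strictly triangular modulo the range of `x`, so `T ^ t` maps `V` into `x V`. Since `T`
commutes with `x`, `(T ^ t) ^ N` maps `V` into `x ^ N V`. -/
theorem isNilpotent_of_apply_mem (H : IsAdaptedChain x t W e μ) (hx : IsNilpotent x) {T : End F V}
    (hT : Commute T x) (hTe : ∀ k < t, T (e k) ∈ W k) : IsNilpotent T := by
  have h0 : ∀ k ≤ t, ∀ v ∈ W k, T v ∈ W k := by
    intro k
    induction k with
    | zero =>
      intro _ v hv
      rw [H.zero] at hv ⊢
      obtain ⟨u, rfl⟩ := hv
      exact ⟨T u, by rw [← Module.End.mul_apply, ← hT.eq, Module.End.mul_apply]⟩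
    | succ k ih =>
      intro hk v hv
      rw [H.succ k hk] at hv
      obtain ⟨y, hy, z, hz, rfl⟩ := Submodule.mem_sup.1 hv
      obtain ⟨c, rfl⟩ := Submodule.mem_span_singleton.1 hz
      rw [map_add, map_smul]
      exact H.mono (Nat.le_succ k) hk
        (add_mem (ih (by omega) y hy) (Submodule.smul_mem _ _ (hTe k hk)))
  have h1 : ∀ k ≤ t, ∀ v ∈ W k, (T ^ k) v ∈ LinearMap.range x := by
    intro k
    induction k with
    | zero =>
      intro _ v hv
      simpa [H.zero] using hv
    | succ k ih =>
      intro hk v hv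
      rw [pow_succ, Module.End.mul_apply]
      refine ih (by omega) _ ?_
      rw [H.succ k hk] at hv
      obtain ⟨y, hy, z, hz, rfl⟩ := Submodule.mem_sup.1 hv
      obtain ⟨c, rfl⟩ := Submodule.mem_span_singleton.1 hz
      rw [map_add, map_smul]
      refine add_mem ?_ (Submodule.smul_mem _ _ (hTe k hk))
      exact h0 k (by omega) y hy
  have h2 : ∀ v, ∃ u, (T ^ t) v = x u := fun v => by
    obtain ⟨u, hu⟩ := h1 t le_rfl v (H.top ▸ Submodule.mem_top)
    exact ⟨u, hu.symm⟩
  have h3 : ∀ N v, ∃ u, ((T ^ t) ^ N) v = (x ^ N) u := by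
    intro N
    induction N with
    | zero => exact fun v => ⟨v, by simp⟩
    | succ N ih =>
      intro v
      obtain ⟨u, hu⟩ := h2 v
      obtain ⟨u', hu'⟩ := ih u
      refine ⟨u', ?_⟩
      rw [pow_succ, Module.End.mul_apply, hu, ← Module.End.mul_apply,
        (((hT.pow_left t).pow_left N).eq), Module.End.mul_apply, hu', pow_succ',
        Module.End.mul_apply]
  obtain ⟨N, hN⟩ := hx
  refine ⟨t * N, LinearMap.ext fun v => ?_⟩
  obtain ⟨u, hu⟩ := h3 N v
  rw [pow_mul, hu, hN]
  rfl

/-- For every ordering `ρ` of the Jordan blocks there is an endomorphism commuting with `x` which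
maps the generator of each block to the generator of the next one, multiplied by the least
admissible power of `x`. -/
theorem exists_shift (H : IsAdaptedChain x t W e μ) (hx : IsNilpotent x)
    (ρ : Equiv.Perm (Fin t))
    (hρ : ∀ i j, i < j → μ (ρ i) < μ (ρ j) ∨ ρ j < ρ i) :
    ∃ T : End F V, Commute T x ∧ (∀ k < t, T (e k) ∈ W k) ∧
      (∀ i (hi : i + 1 < t), T (e (ρ ⟨i, by omega⟩)) =
        (x ^ (μ (ρ ⟨i + 1, hi⟩) - μ (ρ ⟨i, by omega⟩))) (e (ρ ⟨i + 1, hi⟩))) ∧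
      ∀ i (hi : i + 1 = t), T (e (ρ ⟨i, by omega⟩)) = 0 := by
  let g : Fin t → V := fun k => if h : (ρ.symm k : ℕ) + 1 < t then
    (x ^ (μ (ρ ⟨ρ.symm k + 1, h⟩) - μ k)) (e (ρ ⟨ρ.symm k + 1, h⟩)) else 0
  obtain ⟨T, hT, hTe⟩ := H.exists_commute_apply_eq hx g (fun k => by
    simp only [g]
    split_ifs with h
    · rw [← Module.End.mul_apply, ← pow_add, H.pow_eq_zero (Fin.is_lt _) (by omega)]
    · simp)
  refine ⟨T, hT, fun k hk => ?_, fun i hi => ?_, fun i hi => ?_⟩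
  · rw [hTe ⟨k, hk⟩]
    simp only [g]
    split_ifs with h
    · have h1 := hρ (ρ.symm ⟨k, hk⟩) ⟨ρ.symm ⟨k, hk⟩ + 1, h⟩ (Fin.lt_def.2 (Nat.lt_succ_self _))
      rw [Equiv.apply_symm_apply] at h1
      set d := μ (ρ ⟨ρ.symm ⟨k, hk⟩ + 1, h⟩) - μ k with hd
      -- Either the next generator occurs earlier in the flag, or a positive power of `x` puts the
      -- image in the range of `x`.
      rcases Nat.eq_zero_or_pos d with h0 | h0
      · rw [h0, pow_zero, Module.End.one_apply]
        refine H.mem (h1.resolve_left ?_) hk.le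
        simp only
        omega
      · refine H.range_le hk.le
          ⟨(x ^ (d - 1)) (e (ρ ⟨ρ.symm ⟨k, hk⟩ + 1, h⟩)), ?_⟩
        rw [← Module.End.mul_apply, ← pow_succ', Nat.sub_add_cancel h0]
    · exact zero_mem _
  · rw [hTe]
    simp only [g, Equiv.symm_apply_apply]
    rw [dif_pos hi]
  · rw [hTe]
    simp only [g, Equiv.symm_apply_apply]
    rw [dif_neg (by omega)]

/-- From the last block back to the first, sizes do not increase, so the shift involves no power of
`x` and the orbit of `e (t - 1)` reaches every generator. -/
theorem exists_cyclic (H : IsAdaptedChain x t W e μ) (hx : IsNilpotent x) :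
    ∃ T : End F V, Commute T x ∧ (∀ k < t, T (e k) ∈ W k) ∧
      ∃ v, ⊤ ≤ Submodule.span F (Set.range fun p : ℕ × ℕ => (T ^ p.1) ((x ^ p.2) v)) := by
  obtain ⟨T, hT, hTe, hTs, -⟩ := H.exists_shift hx Fin.revPerm
    (fun i j hij => Or.inr (Fin.rev_lt_rev.2 hij))
  refine ⟨T, hT, hTe, e (t - 1), ?_⟩
  have hshift : ∀ i < t, (T ^ i) (e (t - 1)) = e (t - 1 - i) := by
    intro i
    induction i with
    | zero => intro _; simp
    | succ i ih =>
      intro hi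
      have h1 := hTs i hi
      simp only [Fin.revPerm_apply, Fin.val_rev] at h1
      rw [pow_succ', Module.End.mul_apply, ih (by omega)]
      have h2 := H.size_mono (i := t - (i + 1 + 1)) (k := t - (i + 1)) (by omega) (by omega)
      rw [Nat.sub_eq_zero_of_le h2, pow_zero, Module.End.one_apply] at h1
      rw [show t - 1 - i = t - (i + 1) by omega, h1]
      congr 1
      omega
  refine (H.eq_top_of_mem hx ?_ ?_).ge
  · intro u hu
    induction hu using Submodule.span_induction with
    | mem u hu =>
      obtain ⟨p, rfl⟩ := hu
      refine Submodule.subset_span ⟨(p.1, p.2 + 1), ?_⟩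
      simp only
      rw [pow_succ', Module.End.mul_apply, ← Module.End.mul_apply, (hT.pow_left _).eq,
        Module.End.mul_apply]
    | zero => simp
    | add u v _ _ hu hv => rw [map_add]; exact add_mem hu hv
    | smul a u _ hu => rw [map_smul]; exact Submodule.smul_mem _ _ hu
  · intro k hk
    refine Submodule.subset_span ⟨(t - 1 - k, 0), ?_⟩
    simp only [pow_zero, Module.End.one_apply]
    rw [hshift _ (by omega)]
    congr 1
    omega

theorem exists_sum_of_apply_eq_zero (H : IsAdaptedChain x t W e μ) (hx : IsNilpotent x) {u : V}
    (hu : x u = 0) : ∃ c : Fin t → F, u = ∑ k, c k • (x ^ (μ k - 1)) (e k) := by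
  classical
  set b := H.basis hx with hb
  refine ⟨fun k => b.repr u ⟨k, ⟨μ k - 1, Nat.sub_lt (H.size_pos k.2) one_pos⟩⟩, ?_⟩
  have hsum := b.sum_repr u
  have hz : ∀ (k : Fin t) (j : Fin (μ k)), (j : ℕ) + 1 < μ k → b.repr u ⟨k, j⟩ = 0 := by
    intro k j hj
    have h1 : b.repr (x u) ⟨k, ⟨j + 1, hj⟩⟩ = b.repr u ⟨k, j⟩ := by
      conv_lhs => rw [← hsum]
      rw [map_sum, map_sum, Finset.sum_apply', Finset.sum_eq_single ⟨k, j⟩]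
      · rw [map_smul, map_smul, hb, H.basis_apply, ← Module.End.mul_apply, ← pow_succ',
          ← H.basis_apply hx k ⟨j + 1, hj⟩]
        simp
      · rintro ⟨k', j'⟩ - hne
        rw [map_smul, map_smul, hb, H.basis_apply, ← Module.End.mul_apply, ← pow_succ']
        by_cases hj' : (j' : ℕ) + 1 < μ k'
        · rw [← H.basis_apply hx k' ⟨j' + 1, hj'⟩, Basis.repr_self, Finsupp.smul_apply,
            Finsupp.single_apply, if_neg, smul_zero]
          intro heq
          apply hne
          obtain ⟨rfl, h2⟩ := Sigma.mk.inj_iff.1 heq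
          have h3 := eq_of_heq h2
          simp only [Fin.mk.injEq, Nat.add_right_cancel_iff] at h3
          rw [Fin.ext h3]
        · rw [H.pow_eq_zero k'.2 (by omega)]
          simp
      · simp
    rw [← h1, hu]
    simp
  conv_lhs => rw [← hsum]
  rw [Fintype.sum_sigma]
  refine Finset.sum_congr rfl fun k _ => ?_
  have hk := H.size_pos k.2
  rw [Finset.sum_eq_single ⟨μ k - 1, Nat.sub_lt hk one_pos⟩]
  · rw [hb, H.basis_apply]
  · intro j _ hj
    have h3 : (j : ℕ) ≠ μ k - 1 := fun h => hj (Fin.ext h)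
    rw [hz k j (by omega), zero_smul]
  · simp

/-- By increasing size, the shift carries each block end exactly to the next one. A nonzero subspace
stable under `T` and `x` meets `ker x`, hence contains the last block end; `w` need only be nonzero
there. -/
theorem exists_cocyclic (H : IsAdaptedChain x t W e μ) (hx : IsNilpotent x) (ht : 0 < t) :
    ∃ T : End F V, Commute T x ∧ (∀ k < t, T (e k) ∈ W k) ∧
      ∃ w : Dual F V, ∀ u, (∀ i j, w ((T ^ i) ((x ^ j) u)) = 0) → u = 0 := by
  classical
  -- Equal sizes are ordered by decreasing index, so that `T (e k)` stays in `W k`.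
  let f : Fin t → ℕ ×ₗ (Fin t)ᵒᵈ := fun k => toLex (μ k, OrderDual.toDual k)
  have hρ : ∀ i j, i < j → μ (Tuple.sort f i) < μ (Tuple.sort f j) ∨
      (μ (Tuple.sort f i) = μ (Tuple.sort f j) ∧ Tuple.sort f j < Tuple.sort f i) := by
    intro i j hij
    have h1 := Tuple.monotone_sort f hij.le
    simp only [Function.comp_apply, f, Prod.Lex.toLex_le_toLex, OrderDual.toDual_le_toDual] at h1
    refine h1.imp_right fun h => ⟨h.1, lt_of_le_of_ne h.2 fun heq => hij.ne ?_⟩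
    exact ((Tuple.sort f).injective heq).symm
  set ρ := Tuple.sort f
  obtain ⟨T, hT, hTe, hTs, hTl⟩ := H.exists_shift hx ρ (fun i j hij => (hρ i j hij).imp_right And.right)
  let s : Fin t → V := fun i => (x ^ (μ (ρ i) - 1)) (e (ρ i))
  have hs : ∀ i (hi : i + 1 < t), T (s ⟨i, by omega⟩) = s ⟨i + 1, hi⟩ := by
    intro i hi
    have h1 := (hρ ⟨i, by omega⟩ ⟨i + 1, hi⟩ (Fin.lt_def.2 (Nat.lt_succ_self i))).imp_right And.left
    have h2 := H.size_pos (ρ ⟨i, by omega⟩).2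
    simp only [s]
    rw [← Module.End.mul_apply, (hT.pow_right _).eq, Module.End.mul_apply, hTs i hi,
      ← Module.End.mul_apply, ← pow_add]
    congr 2
    omega
  obtain ⟨l, hl⟩ : ∃ l, t = l + 1 := ⟨t - 1, by omega⟩
  have hsT : ∀ d i (hi : i + d < t), (T ^ d) (s ⟨i, by omega⟩) = s ⟨i + d, hi⟩ := by
    intro d
    induction d with
    | zero => intro i hi; simp
    | succ d ih =>
      intro i hi
      rw [pow_succ', Module.End.mul_apply, ih i (by omega), hs (i + d) hi]
      rfl
  have hlast : T (s ⟨l, by omega⟩) = 0 := by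
    simp only [s]
    rw [← Module.End.mul_apply, (hT.pow_right _).eq, Module.End.mul_apply, hTl l hl.symm, map_zero]
  have hli : LinearIndependent F s := by
    have h1 : LinearIndependent F fun k : Fin t => (x ^ (μ k - 1)) (e k) :=
      Fintype.linearIndependent_iff.2 fun c hc k => congrFun (H.top_coeff_eq_zero c hc) k
    exact h1.comp ρ ρ.injective
  obtain ⟨w, hw⟩ : ∃ w : Dual F V, w (s ⟨l, by omega⟩) ≠ 0 := by
    by_contra! hw
    exact hli.ne_zero _ ((Module.forall_dual_apply_eq_zero_iff F _).1 hw)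
  refine ⟨T, hT, hTe, w, ?_⟩
  have hker : ∀ u, x u = 0 → (∀ i, w ((T ^ i) u) = 0) → u = 0 := by
    intro u hu hwu
    obtain ⟨c, hc⟩ := H.exists_sum_of_apply_eq_zero hx hu
    rw [← Equiv.sum_comp ρ] at hc
    by_contra hne
    have hS : (Finset.univ.filter fun i => c (ρ i) ≠ 0).Nonempty := by
      by_contra hS
      rw [Finset.not_nonempty_iff_eq_empty, Finset.filter_eq_empty_iff] at hS
      refine hne (hc.trans (Finset.sum_eq_zero fun i hi => ?_))
      rw [not_not.1 (hS hi), zero_smul]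
    -- The first block end occurring in `u`: `T ^ (l - i₀)` moves it to the last one and kills all
    -- later ones.
    obtain ⟨i₀, hi₀, hmin⟩ := Finset.exists_min_image _ (fun i : Fin t => i) hS
    simp only [Finset.mem_filter, Finset.mem_univ, true_and] at hi₀ hmin
    have h1 : (T ^ (l - i₀)) u = c (ρ i₀) • s ⟨l, by omega⟩ := by
      rw [hc, map_sum, Finset.sum_eq_single i₀]
      · rw [map_smul]
        have h2 := hsT (l - i₀) i₀ (by omega)
        simp only [show (i₀ : ℕ) + (l - i₀) = l by omega] at h2
        exact congrArg _ h2
      · intro i _ hi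
        by_cases hci : c (ρ i) = 0
        · rw [hci, zero_smul, map_zero]
        · have h3 : (i₀ : ℕ) < i := Fin.lt_def.1 (lt_of_le_of_ne (hmin i hci) (Ne.symm hi))
          have h2 := hsT (l - i) i (by omega)
          simp only [show (i : ℕ) + (l - i) = l by omega] at h2
          rw [map_smul, show l - (i₀ : ℕ) = (i - i₀ - 1) + (1 + (l - i)) by omega, pow_add, pow_add,
            Module.End.mul_apply, Module.End.mul_apply]
          change c (ρ i) • (T ^ _) ((T ^ 1) ((T ^ (l - (i : ℕ))) (s i))) = 0
          rw [show s i = s ⟨i, i.2⟩ from rfl, h2, pow_one, hlast, map_zero, smul_zero]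
      · simp
    have h2 := hwu (l - i₀)
    rw [h1, map_smul, smul_eq_mul] at h2
    exact (mul_ne_zero hi₀ hw) h2
  intro u hu
  by_contra hne
  have hex : ∃ j, (x ^ j) u = 0 := by
    obtain ⟨N, hN⟩ := hx
    exact ⟨N, by simp [hN]⟩
  have h0 : Nat.find hex ≠ 0 := by
    intro h0
    have := Nat.find_spec hex
    rw [h0] at this
    exact hne (by simpa using this)
  -- The last nonzero `x ^ j u` lies in `ker x` and inherits the vanishing conditions.
  refine Nat.find_min hex (Nat.sub_lt (Nat.pos_of_ne_zero h0) one_pos) (hker _ ?_ fun i => hu i _)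
  rw [← Module.End.mul_apply, ← pow_succ', Nat.sub_add_cancel (Nat.one_le_iff_ne_zero.2 h0)]
  exact Nat.find_spec hex

end IsAdaptedChain

/-- Every nilpotent endomorphism `A` commuting with a nilpotent `x` lies, together with a cyclic and
a cocyclic one, in a linear space of nilpotent endomorphisms commuting with `x`. -/
theorem exists_cyclic_cocyclic [FiniteDimensional F V] [Nontrivial V] {x A : End F V}
    (hx : IsNilpotent x) (hA : IsNilpotent A) (h : Commute A x) :
    ∃ T₁ T₂ : End F V, Commute T₁ x ∧ Commute T₂ x ∧
      (∀ a b c : F, IsNilpotent (a • A + b • T₁ + c • T₂)) ∧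
      (∃ v, ⊤ ≤ Submodule.span F (Set.range fun p : ℕ × ℕ => (T₁ ^ p.1) ((x ^ p.2) v))) ∧
      ∃ w : Dual F V, ∀ u, (∀ i j, w ((T₂ ^ i) ((x ^ j) u)) = 0) → u = 0 := by
  obtain ⟨t, W, e, μ, H, hAe⟩ := exists_isAdaptedChain hx hA h
  have ht : 0 < t := by
    rcases Nat.eq_zero_or_pos t with rfl | ht
    · obtain ⟨N, hN⟩ := hx
      have h1 : Function.Surjective x := LinearMap.range_eq_top.1 (H.zero ▸ H.top)
      have h2 : Function.Surjective (x ^ N) := by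
        rw [Module.End.coe_pow]
        exact h1.iterate N
      obtain ⟨v, hv⟩ := exists_ne (0 : V)
      obtain ⟨u, hu⟩ := h2 v
      rw [hN] at hu
      exact absurd hu.symm hv
    · exact ht
  obtain ⟨T₁, hT₁, hTe₁, hv⟩ := H.exists_cyclic hx
  obtain ⟨T₂, hT₂, hTe₂, hw⟩ := H.exists_cocyclic hx ht
  refine ⟨T₁, T₂, hT₁, hT₂, fun a b c => ?_, hv, hw⟩
  refine H.isNilpotent_of_apply_mem hx
    (((h.smul_left a).add_left (hT₁.smul_left b)).add_left (hT₂.smul_left c)) fun k hk => ?_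
  exact add_mem (add_mem (Submodule.smul_mem _ _ (hAe k hk)) (Submodule.smul_mem _ _ (hTe₁ k hk)))
    (Submodule.smul_mem _ _ (hTe₂ k hk))

end AdaptedChain

/-! ### Local algebras with two nilpotent generators, and their socle -/

section NilpotentGenerators

variable {F R : Type*} [Field F] [CommRing R] [Algebra F R] {a b : R}

theorem exists_algebraMap_add_of_adjoin_pair (h : Algebra.adjoin F {a, b} = ⊤) (r : R) :
    ∃ (c : F) (s t : R), r = algebraMap F R c + (a * s + b * t) := by
  have hr : r ∈ Algebra.adjoin F {a, b} := h ▸ Algebra.mem_top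
  induction hr using Algebra.adjoin_induction with
  | mem x hx =>
    rcases hx with rfl | rfl
    · exact ⟨0, 1, 0, by simp⟩
    · exact ⟨0, 0, 1, by simp⟩
  | algebraMap c => exact ⟨c, 0, 0, by simp⟩
  | add x y _ _ hx hy =>
    obtain ⟨c, s, t, rfl⟩ := hx
    obtain ⟨c', s', t', rfl⟩ := hy
    exact ⟨c + c', s + s', t + t', by rw [map_add]; ring⟩
  | mul x y _ _ hx hy =>
    obtain ⟨c, s, t, rfl⟩ := hx
    obtain ⟨c', s', t', rfl⟩ := hy
    exact ⟨c * c', algebraMap F R c * s' + s * (algebraMap F R c' + (a * s' + b * t')),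
      algebraMap F R c * t' + t * (algebraMap F R c' + (a * s' + b * t')), by rw [map_mul]; ring⟩

theorem isNilpotent_mul_add_mul (ha : IsNilpotent a) (hb : IsNilpotent b) (s t : R) :
    IsNilpotent (a * s + b * t) :=
  (Commute.all _ _).isNilpotent_add ((Commute.all _ _).isNilpotent_mul_right ha)
    ((Commute.all _ _).isNilpotent_mul_right hb)

theorem isLocalRing_of_adjoin_pair [Nontrivial R] (h : Algebra.adjoin F {a, b} = ⊤)
    (ha : IsNilpotent a) (hb : IsNilpotent b) : IsLocalRing R := by
  refine IsLocalRing.of_isUnit_or_isUnit_one_sub_self fun r => ?_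
  obtain ⟨c, s, t, rfl⟩ := exists_algebraMap_add_of_adjoin_pair h r
  have hn := isNilpotent_mul_add_mul ha hb s t
  by_cases hc : c = 0
  · right
    rw [hc, map_zero, zero_add]
    exact hn.isUnit_one_sub
  · left
    exact hn.isUnit_add_left_of_commute ((IsUnit.mk0 c hc).map (algebraMap F R)) (Commute.all _ _)

theorem mem_localSocle_iff {R : Type u} [CommRing R] [Algebra F R] {a b : R} [IsLocalRing R]
    (h : Algebra.adjoin F {a, b} = ⊤) (ha : IsNilpotent a) (hb : IsNilpotent b) (r : R) :
    r ∈ localSocle R ↔ a * r = 0 ∧ b * r = 0 := by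
  have hmem : ∀ z : R, IsNilpotent z → z ∈ IsLocalRing.maximalIdeal R := fun z hz => by
    rw [IsLocalRing.mem_maximalIdeal]
    exact fun hu => hz.not_isUnit hu
  rw [localSocle, Submodule.mem_annihilator]
  constructor
  · intro hr
    exact ⟨by rw [mul_comm]; exact hr a (hmem a ha), by rw [mul_comm]; exact hr b (hmem b hb)⟩
  · rintro ⟨h1, h2⟩ z hz
    obtain ⟨c, s, t, rfl⟩ := exists_algebraMap_add_of_adjoin_pair h z
    have hc : c = 0 := by
      by_contra hc
      rw [IsLocalRing.mem_maximalIdeal] at hz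
      exact hz ((isNilpotent_mul_add_mul ha hb s t).isUnit_add_left_of_commute
        ((IsUnit.mk0 c hc).map (algebraMap F R)) (Commute.all _ _))
    rw [hc, map_zero, zero_add, smul_eq_mul]
    linear_combination s * h1 + t * h2

theorem exists_mul_ne_zero_of_isNilpotent (ha : IsNilpotent a) {r : R} (hr : r ≠ 0) :
    ∃ k, r * a ^ k ≠ 0 ∧ a * (r * a ^ k) = 0 := by
  classical
  have hex : ∃ k, r * a ^ k = 0 := by
    obtain ⟨N, hN⟩ := ha
    exact ⟨N, by simp [hN]⟩
  have h0 : Nat.find hex ≠ 0 := by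
    intro h0
    have := Nat.find_spec hex
    rw [h0] at this
    exact hr (by simpa using this)
  refine ⟨Nat.find hex - 1, Nat.find_min hex (Nat.sub_lt (Nat.pos_of_ne_zero h0) one_pos), ?_⟩
  have := Nat.find_spec hex
  rw [← Nat.sub_add_cancel (Nat.one_le_iff_ne_zero.2 h0), pow_succ] at this
  linear_combination this

/-- Multiply by `a` as long as the product is nonzero, then by `b`. -/
theorem exists_mul_mem_socle (ha : IsNilpotent a) (hb : IsNilpotent b) {r : R} (hr : r ≠ 0) :
    ∃ k, r * k ≠ 0 ∧ a * (r * k) = 0 ∧ b * (r * k) = 0 := by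
  obtain ⟨i, hi, hai⟩ := exists_mul_ne_zero_of_isNilpotent ha hr
  obtain ⟨j, hj, hbj⟩ := exists_mul_ne_zero_of_isNilpotent hb hi
  refine ⟨a ^ i * b ^ j, by rwa [← mul_assoc], ?_, by rwa [← mul_assoc r]⟩
  linear_combination b ^ j * hai

theorem isArtinianGorenstein_of_socle {R : Type u} [CommRing R] [Algebra F R] {a b : R}
    [Nontrivial R] [FiniteDimensional F R] (h : Algebra.adjoin F {a, b} = ⊤) (ha : IsNilpotent a)
    (hb : IsNilpotent b)
    (hs : ∀ r s : R, a * r = 0 → b * r = 0 → a * s = 0 → b * s = 0 → r ≠ 0 →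
      ∃ c : F, s = c • r) :
    IsArtinianGorenstein R := by
  have hloc := isLocalRing_of_adjoin_pair h ha hb
  refine ⟨IsArtinianRing.of_finite F R, hloc, ?_⟩
  rw [isSimpleModule_iff_toSpanSingleton_surjective]
  constructor
  · obtain ⟨k, hk, h1, h2⟩ := exists_mul_mem_socle ha hb (one_ne_zero (α := R))
    exact ⟨⟨⟨1 * k, (mem_localSocle_iff h ha hb _).2 ⟨h1, h2⟩⟩, 0, fun h => hk (congrArg Subtype.val h)⟩⟩
  · rintro ⟨r, hr⟩ hne ⟨s, hs'⟩
    obtain ⟨hr1, hr2⟩ := (mem_localSocle_iff h ha hb _).1 hr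
    obtain ⟨hs1, hs2⟩ := (mem_localSocle_iff h ha hb _).1 hs'
    obtain ⟨c, hc⟩ := hs r s hr1 hr2 hs1 hs2 fun h0 => hne (Subtype.ext h0)
    refine ⟨algebraMap F R c, Subtype.ext ?_⟩
    simp [hc, Algebra.smul_def]

/-- In a Gorenstein ring, there is a socle element which is a multiple of every nonzero element. -/
theorem IsArtinianGorenstein.exists_socle_generator {R : Type u} [CommRing R] [Algebra F R]
    {a b : R} (hR : IsArtinianGorenstein R) (h : Algebra.adjoin F {a, b} = ⊤)
    (ha : IsNilpotent a) (hb : IsNilpotent b) :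
    ∃ s : R, s ≠ 0 ∧ ∀ r : R, r ≠ 0 → ∃ k, s = k * r := by
  obtain ⟨-, hloc, hsimple⟩ := hR
  rw [isSimpleModule_iff_toSpanSingleton_surjective] at hsimple
  obtain ⟨hnt, hsurj⟩ := hsimple
  obtain ⟨s, hs⟩ := exists_ne (0 : localSocle R)
  refine ⟨s, fun h0 => hs (Subtype.ext h0), fun r hr => ?_⟩
  obtain ⟨k, hk, h1, h2⟩ := exists_mul_mem_socle ha hb hr
  obtain ⟨l, hl⟩ := hsurj ⟨r * k, (mem_localSocle_iff h ha hb _).2 ⟨h1, h2⟩⟩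
    (fun h0 => hk (congrArg Subtype.val h0)) s
  refine ⟨l * k, ?_⟩
  have hl' : l * (r * k) = s := congrArg Subtype.val hl
  rw [← hl']
  ring

end NilpotentGenerators

/-! ### Koszul homology and the number of equations -/

section Koszul

open Module

theorem Submodule.exists_sup_span_singleton_finrank {F V : Type*} [Field F] [AddCommGroup V]
    [Module F V] [FiniteDimensional F V] {P Q : Submodule F V} {d : ℕ} (hPQ : P ≤ Q)
    (h : finrank F Q ≤ finrank F P + (d + 1)) :
    ∃ z ∈ Q, finrank F Q ≤ finrank F (P ⊔ Submodule.span F {z} : Submodule F V) + d := by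
  rcases eq_or_lt_of_le hPQ with rfl | hlt
  · exact ⟨0, zero_mem _, by
      rw [Submodule.span_zero_singleton, sup_bot_eq]; exact Nat.le_add_right _ _⟩
  · obtain ⟨z, hzQ, hzP⟩ := SetLike.exists_of_lt hlt
    refine ⟨z, hzQ, ?_⟩
    have : P < P ⊔ Submodule.span F {z} := by
      refine lt_of_le_of_ne le_sup_left fun heq => hzP ?_
      rw [heq]
      exact Submodule.mem_sup_right (Submodule.mem_span_singleton_self _)
    have := Submodule.finrank_lt_finrank_of_lt this
    omega

theorem Submodule.exists_add_smul_add_smul_of_finrank_le {F V : Type*} [Field F] [AddCommGroup V]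
    [Module F V] [FiniteDimensional F V] {P Q : Submodule F V} (hPQ : P ≤ Q)
    (h : finrank F Q ≤ finrank F P + 2) :
    ∃ z₁ ∈ Q, ∃ z₂ ∈ Q, ∀ q ∈ Q, ∃ p ∈ P, ∃ c₁ c₂ : F, q = p + c₁ • z₁ + c₂ • z₂ := by
  obtain ⟨z₁, hz₁, h₁⟩ := exists_sup_span_singleton_finrank (d := 1) hPQ h
  have hPQ₁ : P ⊔ Submodule.span F {z₁} ≤ Q :=
    sup_le hPQ ((Submodule.span_singleton_le_iff_mem _ _).2 hz₁)
  obtain ⟨z₂, hz₂, h₂⟩ := exists_sup_span_singleton_finrank (d := 0) hPQ₁ h₁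
  have hPQ₂ : P ⊔ Submodule.span F {z₁} ⊔ Submodule.span F {z₂} = Q :=
    Submodule.eq_of_le_of_finrank_le
      (sup_le hPQ₁ ((Submodule.span_singleton_le_iff_mem _ _).2 hz₂)) h₂
  refine ⟨z₁, hz₁, z₂, hz₂, fun q hq => ?_⟩
  rw [← hPQ₂] at hq
  obtain ⟨y, hy, z, hz, rfl⟩ := Submodule.mem_sup.1 hq
  obtain ⟨p, hp, z', hz', rfl⟩ := Submodule.mem_sup.1 hy
  obtain ⟨c₂, rfl⟩ := Submodule.mem_span_singleton.1 hz
  obtain ⟨c₁, rfl⟩ := Submodule.mem_span_singleton.1 hz'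
  exact ⟨p, hp, c₁, c₂, rfl⟩

variable {F R : Type*} [Field F] [CommRing R] [Algebra F R]

/-- The first Koszul homology of two elements `a`, `b` of `R` has dimension at most two if these
generate an ideal of codimension at most one and have an annihilator of dimension at most one. -/
theorem exists_koszul_cycles [FiniteDimensional F R] [Nontrivial R] {a b : R}
    (h₁ : ∀ r : R, ∃ (c : F) (s t : R), r = algebraMap F R c + (a * s + b * t))
    (h₂ : ∀ r s : R, a * r = 0 → b * r = 0 → a * s = 0 → b * s = 0 → r ≠ 0 → ∃ c : F, s = c • r) :
    ∃ u₁ v₁ u₂ v₂ : R, a * u₁ + b * v₁ = 0 ∧ a * u₂ + b * v₂ = 0 ∧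
      ∀ s t : R, a * s + b * t = 0 → ∃ (r : R) (c₁ c₂ : F),
        s = -(b * r) + c₁ • u₁ + c₂ • u₂ ∧ t = a * r + c₁ • v₁ + c₂ • v₂ := by
  -- The Koszul complex `R → R² → R`. Since `ker d₂` and `coker d₁` have dimension at most one,
  -- rank-nullity bounds `dim ker d₁` by `dim range d₂ + 2`.
  let d₁ : R × R →ₗ[F] R := (LinearMap.mulLeft F a).coprod (LinearMap.mulLeft F b)
  let d₂ : R →ₗ[F] R × R := (-LinearMap.mulLeft F b).prod (LinearMap.mulLeft F a)
  have hd₁ : ∀ s t, d₁ (s, t) = a * s + b * t := fun s t => by simp [d₁]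
  have hd₂ : ∀ r, d₂ r = (-(b * r), a * r) := fun r => by simp [d₂]
  have hle : LinearMap.range d₂ ≤ LinearMap.ker d₁ := by
    rintro _ ⟨r, rfl⟩
    rw [LinearMap.mem_ker, hd₂, hd₁]
    ring
  have hr₁ := LinearMap.finrank_range_add_finrank_ker d₁
  have hr₂ := LinearMap.finrank_range_add_finrank_ker d₂
  rw [Module.finrank_prod] at hr₁
  have hk : finrank F (LinearMap.ker d₂) ≤ 1 := by
    by_cases hbot : LinearMap.ker d₂ = ⊥
    · rw [hbot]; simp
    · obtain ⟨r, hr, hr0⟩ := Submodule.exists_mem_ne_zero_of_ne_bot hbot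
      have hmem : ∀ s, s ∈ LinearMap.ker d₂ → a * s = 0 ∧ b * s = 0 := fun s hs => by
        rw [LinearMap.mem_ker, hd₂, Prod.mk_eq_zero, neg_eq_zero] at hs
        exact hs.symm
      refine finrank_le_one ⟨r, hr⟩ fun s => ?_
      obtain ⟨c, hc⟩ := h₂ r s (hmem r hr).1 (hmem r hr).2 (hmem s s.2).1 (hmem s s.2).2 hr0
      exact ⟨c, Subtype.ext hc.symm⟩
  have hc : finrank F R ≤ finrank F (LinearMap.range d₁) + 1 := by
    have htop : LinearMap.range d₁ ⊔ Submodule.span F {(1 : R)} = ⊤ := by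
      refine top_le_iff.1 fun r _ => ?_
      obtain ⟨c, s, t, rfl⟩ := h₁ r
      rw [add_comm]
      refine Submodule.add_mem_sup ⟨(s, t), hd₁ s t⟩ ?_
      rw [Algebra.algebraMap_eq_smul_one]
      exact Submodule.smul_mem _ _ (Submodule.mem_span_singleton_self _)
    have h3 := Submodule.finrank_add_le_finrank_add_finrank (LinearMap.range d₁)
      (Submodule.span F {(1 : R)})
    rw [htop, finrank_top] at h3
    exact h3.trans (Nat.add_le_add_left (finrank_span_singleton one_ne_zero).le _)
  obtain ⟨⟨u₁, v₁⟩, hz₁, ⟨u₂, v₂⟩, hz₂, H⟩ :=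
    Submodule.exists_add_smul_add_smul_of_finrank_le hle (by omega)
  rw [LinearMap.mem_ker, hd₁] at hz₁ hz₂
  refine ⟨u₁, v₁, u₂, v₂, hz₁, hz₂, fun s t hst => ?_⟩
  obtain ⟨_, ⟨r, rfl⟩, c₁, c₂, hq⟩ := H (s, t) (by rwa [LinearMap.mem_ker, hd₁])
  rw [hd₂] at hq
  exact ⟨r, c₁, c₂, congrArg Prod.fst hq, congrArg Prod.snd hq⟩

/-- A local Gorenstein quotient of finite length of a two-dimensional regular local ring is defined
by two equations. -/
theorem exists_ker_eq_span_pair [FiniteDimensional F R] [Nontrivial R] {S : Type*} [CommRing S]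
    [IsLocalRing S] [IsNoetherianRing S] {x y : S} (hm : IsLocalRing.maximalIdeal S = Ideal.span {x, y})
    (π : S →+* R) (hπ : Function.Surjective π)
    (h₁ : ∀ r : R, ∃ (c : F) (s t : R), r = algebraMap F R c + (π x * s + π y * t))
    (h₂ : ∀ r s : R, π x * r = 0 → π y * r = 0 → π x * s = 0 → π y * s = 0 → r ≠ 0 →
      ∃ c : F, s = c • r) :
    ∃ f g, RingHom.ker π = Ideal.span {f, g} := by
  obtain ⟨u₁, v₁, u₂, v₂, hz₁, hz₂, H⟩ := exists_koszul_cycles h₁ h₂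
  choose l hl using hπ
  let f := x * l u₁ + y * l v₁
  let g := x * l u₂ + y * l v₂
  have hf : f ∈ RingHom.ker π := by simp [f, RingHom.mem_ker, hl, hz₁]
  have hg : g ∈ RingHom.ker π := by simp [g, RingHom.mem_ker, hl, hz₂]
  refine ⟨f, g, le_antisymm ?_ (Ideal.span_le.2 ?_)⟩
  -- Nakayama: it suffices to generate the kernel modulo its product with the maximal ideal.
  · refine Submodule.le_of_le_smul_of_le_jacobson_bot (I := IsLocalRing.maximalIdeal S)
      (IsNoetherian.noetherian _) (IsLocalRing.maximalIdeal_le_jacobson _) fun h hh => ?_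
    have hhm : h ∈ Ideal.span {x, y} :=
      hm ▸ IsLocalRing.le_maximalIdeal (RingHom.ker_ne_top π) hh
    obtain ⟨α, β, rfl⟩ := Ideal.mem_span_pair.1 hhm
    rw [RingHom.mem_ker, map_add, map_mul, map_mul, mul_comm, mul_comm (π β)] at hh
    obtain ⟨r, c₁, c₂, hs, ht⟩ := H _ _ hh
    rw [Algebra.smul_def, Algebra.smul_def] at hs ht
    have hi : α + y * l r - l (algebraMap F R c₁) * l u₁ - l (algebraMap F R c₂) * l u₂ ∈
        RingHom.ker π := by
      simp only [RingHom.mem_ker, map_sub, map_add, map_mul, hl]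
      linear_combination hs
    have hj : β - x * l r - l (algebraMap F R c₁) * l v₁ - l (algebraMap F R c₂) * l v₂ ∈
        RingHom.ker π := by
      simp only [RingHom.mem_ker, map_sub, map_mul, hl]
      linear_combination ht
    have hx : x ∈ IsLocalRing.maximalIdeal S := hm ▸ Ideal.subset_span (by simp)
    have hy : y ∈ IsLocalRing.maximalIdeal S := hm ▸ Ideal.subset_span (by simp)
    -- The boundary part of the cycle lifts to `∓x y (l r)`, which cancels; the corrections `hi`,
    -- `hj` lie in the kernel.
    have key : α * x + β * y =
        (l (algebraMap F R c₁) * f + l (algebraMap F R c₂) * g) +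
        (x * (α + y * l r - l (algebraMap F R c₁) * l u₁ - l (algebraMap F R c₂) * l u₂) +
          y * (β - x * l r - l (algebraMap F R c₁) * l v₁ - l (algebraMap F R c₂) * l v₂)) := by
      simp only [f, g]
      ring
    rw [key]
    refine Submodule.add_mem_sup (Ideal.mem_span_pair.2 ⟨_, _, rfl⟩) ?_
    rw [smul_eq_mul]
    exact add_mem (Ideal.mul_mem_mul hx hi) (Ideal.mul_mem_mul hy hj)
  · rintro z (rfl | rfl)
    · exact hf
    · exact hg

end Koszul

/-! ### Regular sequences from unique factorization -/

section RegularSequence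

/-- In a two-dimensional regular local unique factorization domain, two generators of a proper
ideal which is primary to the maximal ideal form a regular sequence. -/
theorem isRegular_pair {S : Type*} [CommRing S] [IsDomain S] [IsLocalRing S] [IsNoetherianRing S]
    [UniqueFactorizationMonoid S] {x y : S}
    (hm : IsLocalRing.maximalIdeal S = Ideal.span {x, y}) (hxy : ¬ x ∣ y) (hyx : ¬ y ∣ x)
    {f g : S} {N : ℕ} (hI : Ideal.span {f, g} ≠ ⊤) (hxN : x ^ N ∈ Ideal.span {f, g})
    (hyN : y ^ N ∈ Ideal.span {f, g}) :
    RingTheory.Sequence.IsRegular S [f, g] := by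
  -- A common prime factor `q` divides `x` and `y`. As `q ∈ (x, y)`, cancelling `q` makes one
  -- cofactor a unit, and then one of `x`, `y` divides the other.
  have hfac : ∀ q, q ∣ f → q ∣ g → ¬ Prime q := by
    intro q hqf hqg hq
    have hdvd : ∀ z ∈ Ideal.span {f, g}, q ∣ z := by
      intro z hz
      obtain ⟨α, β, rfl⟩ := Ideal.mem_span_pair.1 hz
      exact dvd_add (hqf.mul_left _) (hqg.mul_left _)
    obtain ⟨α, rfl⟩ := hq.dvd_of_dvd_pow (hdvd _ hxN)
    obtain ⟨β, rfl⟩ := hq.dvd_of_dvd_pow (hdvd _ hyN)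
    have hqm : q ∈ Ideal.span {q * α, q * β} := by
      rw [← hm, IsLocalRing.mem_maximalIdeal]
      exact hq.not_isUnit
    obtain ⟨c, d, hcd⟩ := Ideal.mem_span_pair.1 hqm
    have h1 : c * α + d * β = 1 := mul_left_cancel₀ hq.ne_zero (by linear_combination hcd)
    rcases IsLocalRing.isUnit_or_isUnit_of_add_one h1 with hu | hu
    · exact hxy (mul_dvd_mul_left q ((isUnit_of_mul_isUnit_right hu).dvd))
    · exact hyx (mul_dvd_mul_left q ((isUnit_of_mul_isUnit_right hu).dvd))
  have hfm : f ∈ IsLocalRing.maximalIdeal S :=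
    IsLocalRing.le_maximalIdeal hI (Ideal.subset_span (by simp))
  have hgm : g ∈ IsLocalRing.maximalIdeal S :=
    IsLocalRing.le_maximalIdeal hI (Ideal.subset_span (by simp))
  have hf0 : f ≠ 0 := by
    rintro rfl
    have hg0 : g ≠ 0 := by
      rintro rfl
      have hx0 : x = 0 := by
        have : x ^ N = 0 := by simpa using hxN
        exact eq_zero_of_pow_eq_zero this
      exact hyx (hx0 ▸ dvd_zero y)
    obtain ⟨q, hq, hqg⟩ := WfDvdMonoid.exists_irreducible_factor
      ((IsLocalRing.mem_maximalIdeal _).1 hgm) hg0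
    exact hfac q (dvd_zero q) hqg hq.prime
  refine RingTheory.Sequence.IsRegular.of_isWeaklyRegular_of_mem_maximalIdeal S ?_ ?_
  · rintro z hz
    rcases List.mem_pair.1 hz with rfl | rfl
    · exact hfm
    · exact hgm
  · rw [RingTheory.Sequence.isWeaklyRegular_cons_iff,
      RingTheory.Sequence.isWeaklyRegular_singleton_iff]
    refine ⟨?_, ?_⟩
    · rw [isSMulRegular_iff_right_eq_zero_of_smul]
      intro z hz
      exact (mul_eq_zero.1 hz).resolve_left hf0
    · rw [isSMulRegular_quotient_iff_mem_of_smul_mem]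
      intro z hz
      rw [Submodule.mem_smul_pointwise_iff_exists] at hz ⊢
      obtain ⟨w, -, hw⟩ := hz
      obtain ⟨k, rfl⟩ := UniqueFactorizationMonoid.dvd_of_dvd_mul_right_of_no_prime_factors hf0
        (fun h1 h2 => hfac _ h1 h2) (⟨w, hw.symm⟩ : f ∣ g * z)
      exact ⟨k, trivial, rfl⟩

end RegularSequence

/-! ### Presentation over the local ring of the plane at the origin -/

section CompleteIntersection

open MvPolynomial

variable (F : Type u) [Field F]

/-- The maximal ideal of the origin in the coordinate ring of the affine plane. -/
noncomputable def planeOrigin : Ideal (MvPolynomial (Fin 2) F) :=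
  RingHom.ker (constantCoeff : MvPolynomial (Fin 2) F →+* F)

instance : (planeOrigin F).IsPrime := RingHom.ker_isPrime _

variable {F}

theorem mem_planeOrigin {p : MvPolynomial (Fin 2) F} : p ∈ planeOrigin F ↔ constantCoeff p = 0 :=
  Iff.rfl

theorem planeOrigin_eq_span : planeOrigin F = Ideal.span {X 0, X 1} := by
  refine le_antisymm (fun p hp => ?_) (Ideal.span_le.2 ?_)
  · have key : ∀ q : MvPolynomial (Fin 2) F, q - C (constantCoeff q) ∈
        (Ideal.span {X 0, X 1} : Ideal (MvPolynomial (Fin 2) F)) := by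
      intro q
      induction q using MvPolynomial.induction_on with
      | C a => simp
      | add p q hp hq =>
        have := add_mem hp hq
        rw [map_add, map_add]
        convert! this using 1
        ring
      | mul_X p i _ =>
        rw [map_mul, constantCoeff_X, mul_zero, map_zero, sub_zero]
        refine Ideal.mul_mem_left _ _ (Ideal.subset_span ?_)
        fin_cases i <;> simp
    have := key p
    rwa [mem_planeOrigin.1 hp, map_zero, sub_zero] at this
  · rintro z (rfl | rfl) <;> exact mem_planeOrigin.2 (constantCoeff_X _ _)

/-- Setting `X i = 0` in `X j * s = X i * r` kills `s` on that axis, whereas the denominator `s`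
must not vanish at the origin. -/
theorem not_X_dvd_X_localization {i j : Fin 2} (hij : j ≠ i) :
    ¬ algebraMap (MvPolynomial (Fin 2) F) (Localization.AtPrime (planeOrigin F)) (X i) ∣
      algebraMap (MvPolynomial (Fin 2) F) (Localization.AtPrime (planeOrigin F)) (X j) := by
  rintro ⟨z, hz⟩
  obtain ⟨⟨r, ⟨s, hs0⟩⟩, hrs⟩ := IsLocalization.surj (planeOrigin F).primeCompl z
  have h1 : (X j : MvPolynomial (Fin 2) F) * s = X i * r := by
    apply IsLocalization.injective (Localization.AtPrime (planeOrigin F))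
      (planeOrigin F).primeCompl_le_nonZeroDivisors
    rw [map_mul, map_mul, hz, mul_assoc]
    exact congrArg _ hrs
  let φ : MvPolynomial (Fin 2) F →+* Polynomial F :=
    eval₂Hom Polynomial.C fun k => if k = i then 0 else Polynomial.X
  have h2 := congrArg φ h1
  have hφ : (Polynomial.evalRingHom 0).comp φ = constantCoeff := by
    refine MvPolynomial.ringHom_ext (fun a => ?_) fun k => ?_
    · simp [φ]
    · by_cases hk : k = i <;> simp [φ, hk]
  have hs : φ s = 0 := by
    simp only [map_mul] at h2
    simpa [φ, hij] using h2
  refine hs0 (mem_planeOrigin.2 ?_)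
  rw [← hφ, RingHom.comp_apply, hs, map_zero]

/-- An artinian algebra generated by two nilpotent elements, the socle of which is a line, is a
complete intersection. -/
theorem isArtinianCompleteIntersection_of_socle {R : Type u} [CommRing R] [Algebra F R] {a b : R}
    [Nontrivial R] [FiniteDimensional F R] (h : Algebra.adjoin F {a, b} = ⊤) (ha : IsNilpotent a)
    (hb : IsNilpotent b)
    (hs : ∀ r s : R, a * r = 0 → b * r = 0 → a * s = 0 → b * s = 0 → r ≠ 0 →
      ∃ c : F, s = c • r) :
    IsArtinianCompleteIntersection R := by
  have hloc := isLocalRing_of_adjoin_pair h ha hb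
  refine ⟨IsArtinianRing.of_finite F R, hloc, ?_⟩
  let φ : MvPolynomial (Fin 2) F →ₐ[F] R := aeval ![a, b]
  have hφ0 : φ (X 0) = a := by simp [φ]
  have hφ1 : φ (X 1) = b := by simp [φ]
  have hφ : Function.Surjective φ := by
    rw [← AlgHom.range_eq_top, ← top_le_iff, ← h]
    refine Algebra.adjoin_le ?_
    rintro z (rfl | rfl)
    · exact ⟨_, hφ0⟩
    · exact ⟨_, hφ1⟩
  have hunit : ∀ s : (planeOrigin F).primeCompl, IsUnit ((φ : MvPolynomial (Fin 2) F →+* R) s) := by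
    rintro ⟨s, hs0⟩
    obtain ⟨c, hc, z, hz, hsz⟩ : ∃ c : F, c ≠ 0 ∧ ∃ z ∈ planeOrigin F, s =
        z + C c :=
      ⟨constantCoeff s, hs0, s - C (constantCoeff s),
        mem_planeOrigin.2 (by simp), by ring⟩
    rw [planeOrigin_eq_span] at hz
    obtain ⟨p, q, rfl⟩ := Ideal.mem_span_pair.1 hz
    have hn := isNilpotent_mul_add_mul ha hb (φ p) (φ q)
    have : (φ : MvPolynomial (Fin 2) F →+* R) s = algebraMap F R c + (a * φ p + b * φ q) := by
      rw [hsz, RingHom.coe_coe, map_add, map_add, map_mul, map_mul, hφ0, hφ1]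
      change _ + φ (algebraMap F _ c) = _
      rw [AlgHom.commutes]
      ring
    rw [this]
    exact hn.isUnit_add_left_of_commute ((IsUnit.mk0 c hc).map (algebraMap F R)) (Commute.all _ _)
  let S := Localization.AtPrime (planeOrigin F)
  let π : S →+* R := IsLocalization.lift hunit
  have hπ : ∀ p, π (algebraMap _ S p) = φ p := fun p => IsLocalization.lift_eq hunit p
  have hπs : Function.Surjective π := fun r => by
    obtain ⟨p, rfl⟩ := hφ r
    exact ⟨_, hπ p⟩
  have hm : IsLocalRing.maximalIdeal S = Ideal.span {algebraMap (MvPolynomial (Fin 2) F) S (X 0), algebraMap (MvPolynomial (Fin 2) F) S (X 1)} := by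
    rw [← Localization.AtPrime.map_eq_maximalIdeal, ← Set.image_pair, ← Ideal.map_span,
      ← planeOrigin_eq_span]
  have hreg : IsRegularLocalRing S :=
    IsRegularRing.isRegularLocalRing_localization (planeOrigin F)
  have hx : π (algebraMap (MvPolynomial (Fin 2) F) S (X 0)) = a := (hπ _).trans hφ0
  have hy : π (algebraMap (MvPolynomial (Fin 2) F) S (X 1)) = b := (hπ _).trans hφ1
  obtain ⟨f, g, hfg⟩ := exists_ker_eq_span_pair (F := F) hm π hπs
    (by rw [hx, hy]; exact exists_algebraMap_add_of_adjoin_pair h) (by rw [hx, hy]; exact hs)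
  obtain ⟨N, hN⟩ := ha
  obtain ⟨M, hM⟩ := hb
  refine ⟨S, inferInstance, hreg, [f, g], ?_, ⟨?_⟩⟩
  · refine isRegular_pair hm (not_X_dvd_X_localization (by decide))
      (not_X_dvd_X_localization (by decide)) (N := N + M) ?_ ?_ ?_
    · rw [← hfg]; exact RingHom.ker_ne_top π
    · rw [← hfg, RingHom.mem_ker, map_pow, hx, pow_add, hN, zero_mul]
    · rw [← hfg, RingHom.mem_ker, map_pow, hy, pow_add, hM, mul_zero]
  · refine ((Ideal.quotEquivOfEq ?_).trans (RingHom.quotientKerEquivOfSurjective hπs)).symm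
    rw [hfg, Ideal.ofList_cons, Ideal.ofList_singleton, ← Ideal.span_union, Set.singleton_union]

end CompleteIntersection

/-! ### Cyclic vectors and the Gorenstein property -/

section PairAlgebra

open Matrix

variable {F : Type u} [Field F] {n : ℕ}

theorem left_mem_pairAlgebra (A B : Matrix (Fin n) (Fin n) F) : A ∈ pairAlgebra A B :=
  Algebra.subset_adjoin (Set.mem_insert _ _)

theorem right_mem_pairAlgebra (A B : Matrix (Fin n) (Fin n) F) : B ∈ pairAlgebra A B :=
  Algebra.subset_adjoin (Set.mem_insert_of_mem _ rfl)

theorem transpose_mem_pairAlgebra {A B X : Matrix (Fin n) (Fin n) F} (hX : X ∈ pairAlgebra A B) :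
    Xᵀ ∈ pairAlgebra Aᵀ Bᵀ := by
  induction hX using Algebra.adjoin_induction with
  | mem X hX =>
    rcases hX with rfl | rfl
    · exact left_mem_pairAlgebra _ _
    · exact right_mem_pairAlgebra _ _
  | algebraMap c =>
    rw [Matrix.algebraMap_eq_diagonal, Matrix.diagonal_transpose, ← Matrix.algebraMap_eq_diagonal]
    exact Subalgebra.algebraMap_mem _ c
  | add X Y _ _ hX hY => rw [Matrix.transpose_add]; exact add_mem hX hY
  | mul X Y _ _ hX hY => rw [Matrix.transpose_mul]; exact mul_mem hY hX

theorem isCyclicVector_transpose_iff {A B : Matrix (Fin n) (Fin n) F} {w : Fin n → F} :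
    IsCyclicVector (pairAlgebra Aᵀ Bᵀ) w ↔ ∀ u, ∃ X ∈ pairAlgebra A B, Xᵀ *ᵥ w = u := by
  refine forall_congr' fun u => ⟨?_, ?_⟩
  · rintro ⟨X, hX, rfl⟩
    refine ⟨Xᵀ, ?_, by rw [transpose_transpose]⟩
    simpa using transpose_mem_pairAlgebra hX
  · rintro ⟨X, hX, rfl⟩
    exact ⟨Xᵀ, transpose_mem_pairAlgebra hX, rfl⟩

namespace nilpotentCommutator

variable {B : Matrix (Fin n) (Fin n) F} (A : nilpotentCommutator B)

/-- The first generator of the algebra of a commuting pair. -/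
def leftGenerator : pairAlgebra A.1 B := ⟨A.1, left_mem_pairAlgebra _ _⟩

/-- The second generator of the algebra of a commuting pair. -/
def rightGenerator : pairAlgebra A.1 B := ⟨B, right_mem_pairAlgebra _ _⟩

theorem adjoin_left_right : Algebra.adjoin F {(leftGenerator A), (rightGenerator A)} = ⊤ := by
  have h : ({leftGenerator A, rightGenerator A} : Set (pairAlgebra A.1 B)) =
      (fun X : pairAlgebra A.1 B => X.1) ⁻¹' {A.1, B} := by
    ext ⟨X, hX⟩
    simp [leftGenerator, rightGenerator]
  rw [h]
  exact Algebra.adjoin_adjoin_coe_preimage (R := F) (s := {A.1, B})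

theorem isNilpotent_left : IsNilpotent (leftGenerator A) := by
  obtain ⟨N, hN⟩ := A.2.1
  exact ⟨N, Subtype.ext hN⟩

theorem isNilpotent_right (hB : IsNilpotent B) : IsNilpotent (rightGenerator A) := by
  obtain ⟨N, hN⟩ := hB
  exact ⟨N, Subtype.ext hN⟩

theorem mulVec_comm {X Y : Matrix (Fin n) (Fin n) F} (hX : X ∈ pairAlgebra A.1 B)
    (hY : Y ∈ pairAlgebra A.1 B) (v : Fin n → F) : X *ᵥ (Y *ᵥ v) = Y *ᵥ (X *ᵥ v) := by
  have h : X * Y = Y * X :=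
    congrArg Subtype.val (mul_comm (⟨X, hX⟩ : pairAlgebra A.1 B) ⟨Y, hY⟩)
  rw [mulVec_mulVec, mulVec_mulVec, h]

/-- By commutativity `X` kills every `Y v`, and these exhaust the space. -/
theorem eq_zero_of_mulVec_eq_zero {v : Fin n → F} (hv : IsCyclicVector (pairAlgebra A.1 B) v)
    {X : Matrix (Fin n) (Fin n) F} (hX : X ∈ pairAlgebra A.1 B) (h : X *ᵥ v = 0) : X = 0 := by
  refine Matrix.ext_of_mulVec_single fun i => ?_
  obtain ⟨Y, hY, hYv⟩ := hv (Pi.single i 1)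
  rw [← hYv, mulVec_comm A hX hY, h, mulVec_zero, zero_mulVec]

/-- Evaluation of the algebra of a commuting pair at a vector. -/
def evalAt (v : Fin n → F) : pairAlgebra A.1 B →ₗ[F] (Fin n → F) where
  toFun X := X.1 *ᵥ v
  map_add' _ _ := add_mulVec _ _ _
  map_smul' _ _ := smul_mulVec _ _ _

/-- Evaluation of the transposed algebra of a commuting pair at a vector. -/
def evalTransposeAt (w : Fin n → F) : pairAlgebra A.1 B →ₗ[F] (Fin n → F) where
  toFun X := X.1ᵀ *ᵥ w
  map_add' X Y := by
    rw [← add_mulVec, ← transpose_add]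
    rfl
  map_smul' c X := by
    rw [RingHom.id_apply, ← smul_mulVec, ← transpose_smul]
    rfl

theorem finrank_eq_of_isCyclicVector {v : Fin n → F}
    (hv : IsCyclicVector (pairAlgebra A.1 B) v) : Module.finrank F (pairAlgebra A.1 B) = n := by
  have hbij : Function.Bijective ((evalAt A) v) := by
    constructor
    · rw [injective_iff_map_eq_zero]
      exact fun X hX => Subtype.ext (eq_zero_of_mulVec_eq_zero A hv X.2 hX)
    · intro u
      obtain ⟨X, hX, hu⟩ := hv u
      exact ⟨⟨X, hX⟩, hu⟩
  rw [(LinearEquiv.ofBijective _ hbij).finrank_eq, Module.finrank_fin_fun]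

/-- The algebra acts on `r` by scalars, so `r v` is orthogonal to every `Xᵀ w`, that is, to
everything. -/
theorem eq_zero_of_mem_socle {v w : Fin n → F} (hv : IsCyclicVector (pairAlgebra A.1 B) v)
    (hw : IsCyclicVector (pairAlgebra A.1ᵀ Bᵀ) w) {r : pairAlgebra A.1 B} (h₁ : leftGenerator A * r = 0)
    (h₂ : rightGenerator A * r = 0) (h : w ⬝ᵥ (r.1 *ᵥ v) = 0) : r = 0 := by
  have hr : r.1 *ᵥ v = 0 := by
    rw [← dotProduct_eq_zero_iff]
    intro u
    obtain ⟨X, hX, rfl⟩ := isCyclicVector_transpose_iff.1 hw u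
    obtain ⟨c, s, t, hc⟩ :=
      exists_algebraMap_add_of_adjoin_pair (adjoin_left_right A) (⟨X, hX⟩ : pairAlgebra A.1 B)
    have hXr : (⟨X, hX⟩ : pairAlgebra A.1 B) * r = c • r := by
      rw [hc, Algebra.smul_def]
      linear_combination s * h₁ + t * h₂
    have hXr' : X * r.1 = c • r.1 := congrArg Subtype.val hXr
    rw [dotProduct_comm, mulVec_transpose, ← dotProduct_mulVec, mulVec_mulVec, hXr', smul_mulVec,
      dotProduct_smul, h, smul_zero]
  exact Subtype.ext (eq_zero_of_mulVec_eq_zero A hv r.2 hr)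

theorem exists_smul_of_mem_socle {v w : Fin n → F} (hv : IsCyclicVector (pairAlgebra A.1 B) v)
    (hw : IsCyclicVector (pairAlgebra A.1ᵀ Bᵀ) w) (r s : pairAlgebra A.1 B)
    (hr₁ : leftGenerator A * r = 0) (hr₂ : rightGenerator A * r = 0) (hs₁ : leftGenerator A * s = 0)
    (hs₂ : rightGenerator A * s = 0)
    (hr : r ≠ 0) : ∃ c : F, s = c • r := by
  have hne : w ⬝ᵥ (r.1 *ᵥ v) ≠ 0 := fun h => hr (eq_zero_of_mem_socle A hv hw hr₁ hr₂ h)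
  refine ⟨(w ⬝ᵥ (s.1 *ᵥ v)) / (w ⬝ᵥ (r.1 *ᵥ v)), sub_eq_zero.1 ?_⟩
  refine eq_zero_of_mem_socle A hv hw ?_ ?_ ?_
  · rw [mul_sub, mul_smul_comm, hr₁, hs₁, smul_zero, sub_zero]
  · rw [mul_sub, mul_smul_comm, hr₂, hs₂, smul_zero, sub_zero]
  · change w ⬝ᵥ ((s.1 - _ • r.1) *ᵥ v) = 0
    rw [sub_mulVec, smul_mulVec, dotProduct_sub, dotProduct_smul, smul_eq_mul,
      div_mul_cancel₀ _ hne, sub_self]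

theorem isArtinianGorenstein (hn : 0 < n) (hB : IsNilpotent B) {v w : Fin n → F}
    (hv : IsCyclicVector (pairAlgebra A.1 B) v) (hw : IsCyclicVector (pairAlgebra A.1ᵀ Bᵀ) w) :
    IsArtinianGorenstein (pairAlgebra A.1 B) := by
  have : NeZero n := ⟨hn.ne'⟩
  exact isArtinianGorenstein_of_socle (adjoin_left_right A) (isNilpotent_left A)
    ((isNilpotent_right A) hB) ((exists_smul_of_mem_socle A) hv hw)

theorem isArtinianCompleteIntersection (hn : 0 < n) (hB : IsNilpotent B) {v w : Fin n → F}
    (hv : IsCyclicVector (pairAlgebra A.1 B) v) (hw : IsCyclicVector (pairAlgebra A.1ᵀ Bᵀ) w) :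
    IsArtinianCompleteIntersection (pairAlgebra A.1 B) := by
  have : NeZero n := ⟨hn.ne'⟩
  exact isArtinianCompleteIntersection_of_socle (adjoin_left_right A) (isNilpotent_left A)
    ((isNilpotent_right A) hB) ((exists_smul_of_mem_socle A) hv hw)

/-- Choose `v` and `w` not killed by a socle generator and its transpose. Any nonzero `X` divides
that generator, so both evaluations are injective. -/
theorem exists_isCyclicVector (hB : IsNilpotent B) (hG : IsArtinianGorenstein (pairAlgebra A.1 B))
    (hd : Module.finrank F (pairAlgebra A.1 B) = n) :
    (∃ v, IsCyclicVector (pairAlgebra A.1 B) v) ∧ ∃ w, IsCyclicVector (pairAlgebra A.1ᵀ Bᵀ) w := by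
  obtain ⟨s, hs0, hs⟩ := hG.exists_socle_generator (adjoin_left_right A) (isNilpotent_left A)
    ((isNilpotent_right A) hB)
  have hs0' : s.1 ≠ 0 := fun h => hs0 (Subtype.ext h)
  have hfin : Module.finrank F (pairAlgebra A.1 B) = Module.finrank F (Fin n → F) := by
    rw [hd, Module.finrank_fin_fun]
  constructor
  · obtain ⟨v, hv⟩ : ∃ v, s.1 *ᵥ v ≠ 0 := by
      by_contra! h
      exact hs0' (Matrix.ext_of_mulVec_single fun i => by rw [h, zero_mulVec])
    refine ⟨v, fun u => ?_⟩
    have hinj : Function.Injective ((evalAt A) v) := by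
      rw [injective_iff_map_eq_zero]
      intro X hX
      by_contra hne
      obtain ⟨k, rfl⟩ := hs X hne
      refine hv ?_
      change (k.1 * X.1) *ᵥ v = 0
      rw [← mulVec_mulVec, show X.1 *ᵥ v = 0 from hX, mulVec_zero]
    obtain ⟨X, hX⟩ := (LinearMap.injective_iff_surjective_of_finrank_eq_finrank hfin).1 hinj u
    exact ⟨X.1, X.2, hX⟩
  · obtain ⟨w, hw⟩ : ∃ w, s.1ᵀ *ᵥ w ≠ 0 := by
      by_contra! h
      refine hs0' (transpose_injective (Matrix.ext_of_mulVec_single fun i => ?_))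
      rw [h, transpose_zero, zero_mulVec]
    refine ⟨w, isCyclicVector_transpose_iff.2 fun u => ?_⟩
    have hinj : Function.Injective ((evalTransposeAt A) w) := by
      rw [injective_iff_map_eq_zero]
      intro X hX
      by_contra hne
      obtain ⟨k, hk⟩ := hs X hne
      refine hw ?_
      rw [show s.1 = X.1 * k.1 from congrArg Subtype.val (hk.trans (mul_comm _ _)), transpose_mul,
        ← mulVec_mulVec, show X.1ᵀ *ᵥ w = 0 from hX, mulVec_zero]
    obtain ⟨X, hX⟩ := (LinearMap.injective_iff_surjective_of_finrank_eq_finrank hfin).1 hinj u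
    exact ⟨X.1, X.2, hX⟩

end nilpotentCommutator

end PairAlgebra

/-! ### Openness of the cyclic conditions, and density along lines -/

section Zariski

open Matrix Topology

variable {F : Type u} [Field F] {n : ℕ}

/-- Evaluation of polynomials in the entries of a generic matrix at the matrix `A`. -/
noncomputable abbrev evalEntries (A : Matrix (Fin n) (Fin n) F) :
    MvPolynomial (Fin n × Fin n) F →+* F :=
  MvPolynomial.eval fun ij => A ij.1 ij.2

theorem isOpen_evalEntries_ne_zero (p : MvPolynomial (Fin n × Fin n) F) :
    IsOpen[matrixZariskiTopology F n] {A | evalEntries A p ≠ 0} :=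
  TopologicalSpace.GenerateOpen.basic _ ⟨p, rfl⟩

theorem exists_linearIndependent_fin_of_span_eq_top {ι : Type*} {f : ι → Fin n → F}
    (hf : ⊤ ≤ Submodule.span F (Set.range f)) :
    ∃ k : Fin n → ι, LinearIndependent F (f ∘ k) := by
  obtain ⟨κ, a, -, hspan, hli⟩ := exists_linearIndependent' F f
  let b := Module.Basis.mk hli (hspan ▸ hf)
  have hcard : Module.finrank F (Fin n → F) = n := Module.finrank_fin_fun F
  have : Fintype κ := FiniteDimensional.fintypeBasisIndex b
  have e : Fin n ≃ κ := (Fintype.equivFinOfCardEq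
    ((Module.finrank_eq_card_basis b).symm.trans hcard)).symm
  exact ⟨a ∘ e, hli.comp e e.injective⟩

/-- If the entries of a matrix depend polynomially on `A`, then having a cyclic vector together with
a fixed matrix is an open condition on `A`. -/
theorem isOpen_exists_span_eq_top (G : Matrix (Fin n) (Fin n) (MvPolynomial (Fin n × Fin n) F))
    (C : Matrix (Fin n) (Fin n) F) :
    IsOpen[matrixZariskiTopology F n] {A | ∃ v : Fin n → F, ⊤ ≤ Submodule.span F
      (Set.range fun p : ℕ × ℕ => ((evalEntries A).mapMatrix G ^ p.1 * C ^ p.2) *ᵥ v)} := by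
  let _ := matrixZariskiTopology F n
  refine isOpen_iff_forall_mem_open.2 fun A ⟨v, hv⟩ => ?_
  obtain ⟨k, hk⟩ := exists_linearIndependent_fin_of_span_eq_top hv
  -- The rows are `n` monomials applied to `v` that are independent at the given `A`; where the
  -- determinant is nonzero, the same `v` works.
  let D : Matrix (Fin n) (Fin n) (MvPolynomial (Fin n × Fin n) F) := Matrix.of fun i =>
    (G ^ (k i).1 * (MvPolynomial.C.mapMatrix C) ^ (k i).2) *ᵥ (MvPolynomial.C ∘ v)
  have hD : ∀ A', evalEntries A' D.det = (Matrix.of fun i =>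
      ((evalEntries A').mapMatrix G ^ (k i).1 * C ^ (k i).2) *ᵥ v).det := by
    intro A'
    rw [RingHom.map_det]
    congr 1
    ext i j
    have hC : (evalEntries A').mapMatrix (MvPolynomial.C.mapMatrix C) = C := by
      ext a b
      simp [evalEntries]
    have hv' : evalEntries A' ∘ MvPolynomial.C ∘ v = v := by
      ext a
      simp [evalEntries]
    change evalEntries A' (((G ^ (k i).1 * (MvPolynomial.C.mapMatrix C) ^ (k i).2) *ᵥ
      (MvPolynomial.C ∘ v)) j) = (((evalEntries A').mapMatrix G ^ (k i).1 * C ^ (k i).2) *ᵥ v) j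
    rw [RingHom.map_mulVec, hv', ← RingHom.mapMatrix_apply, map_mul, map_pow, map_pow, hC]
  refine ⟨{A' | evalEntries A' D.det ≠ 0}, fun A' hA' => ⟨v, ?_⟩, isOpen_evalEntries_ne_zero _, ?_⟩
  · have hu := isUnit_iff_ne_zero.2 hA'
    rw [hD, ← Matrix.isUnit_iff_isUnit_det, ← Matrix.linearIndependent_rows_iff_isUnit] at hu
    have htop := hu.span_eq_top_of_card_eq_finrank' (by simp)
    rw [← htop]
    refine Submodule.span_mono ?_
    rintro _ ⟨i, rfl⟩
    exact ⟨k i, rfl⟩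
  · change evalEntries A D.det ≠ 0
    rw [hD, ← isUnit_iff_ne_zero, ← Matrix.isUnit_iff_isUnit_det,
      ← Matrix.linearIndependent_rows_iff_isUnit]
    exact hk

theorem mem_span_of_mem_pairAlgebra {A B X : Matrix (Fin n) (Fin n) F} (h : A * B = B * A)
    (hX : X ∈ pairAlgebra A B) :
    X ∈ Submodule.span F (Set.range fun p : ℕ × ℕ => A ^ p.1 * B ^ p.2) := by
  induction hX using Algebra.adjoin_induction with
  | mem X hX =>
    rcases hX with rfl | rfl
    · exact Submodule.subset_span ⟨(1, 0), by simp⟩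
    · exact Submodule.subset_span ⟨(0, 1), by simp⟩
  | algebraMap c =>
    rw [Algebra.algebraMap_eq_smul_one]
    exact Submodule.smul_mem _ _ (Submodule.subset_span ⟨(0, 0), by simp⟩)
  | add X Y _ _ hX hY => exact add_mem hX hY
  | mul X Y _ _ hX hY =>
    have h1 := Submodule.mul_mem_mul hX hY
    rw [Submodule.span_mul_span] at h1
    refine Submodule.span_mono ?_ h1
    rintro _ ⟨_, ⟨p, rfl⟩, _, ⟨q, rfl⟩, rfl⟩
    refine ⟨(p.1 + q.1, p.2 + q.2), ?_⟩
    have h2 : A ^ q.1 * B ^ p.2 = B ^ p.2 * A ^ q.1 := (Commute.pow_pow h q.1 p.2).eq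
    simp only [pow_add]
    rw [mul_assoc, ← mul_assoc (A ^ q.1), h2]
    simp only [mul_assoc]

theorem isCyclicVector_iff_span {A B : Matrix (Fin n) (Fin n) F} (h : A * B = B * A)
    (v : Fin n → F) : IsCyclicVector (pairAlgebra A B) v ↔
      ⊤ ≤ Submodule.span F (Set.range fun p : ℕ × ℕ => (A ^ p.1 * B ^ p.2) *ᵥ v) := by
  have hspan : Submodule.span F (Set.range fun p : ℕ × ℕ => (A ^ p.1 * B ^ p.2) *ᵥ v) =
      (Submodule.span F (Set.range fun p : ℕ × ℕ => A ^ p.1 * B ^ p.2)).map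
        ((Matrix.mulVecBilin F F).flip v) := by
    rw [Submodule.map_span, ← Set.range_comp]
    rfl
  constructor
  · intro hv u _
    obtain ⟨X, hX, rfl⟩ := hv u
    rw [hspan]
    exact ⟨X, mem_span_of_mem_pairAlgebra h hX, rfl⟩
  · intro htop u
    have hu := htop (Submodule.mem_top (x := u))
    rw [hspan] at hu
    obtain ⟨X, hX, rfl⟩ := hu
    refine ⟨X, ?_, rfl⟩
    have hle : Submodule.span F (Set.range fun p : ℕ × ℕ => A ^ p.1 * B ^ p.2) ≤
        Subalgebra.toSubmodule (pairAlgebra A B) := by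
      rw [Submodule.span_le]
      rintro _ ⟨p, rfl⟩
      exact (pairAlgebra A B).mul_mem (pow_mem (left_mem_pairAlgebra A B) _) (pow_mem (right_mem_pairAlgebra A B) _)
    exact hle hX

theorem transpose_mul_comm {A B : Matrix (Fin n) (Fin n) F} (h : A * B = B * A) :
    Aᵀ * Bᵀ = Bᵀ * Aᵀ := by
  rw [← transpose_mul, ← transpose_mul, h]

namespace nilpotentCommutator

variable (B : Matrix (Fin n) (Fin n) F)

/-- The matrices `A` in the nilpotent commutator such that `(A, B)` has a cyclic vector. -/
def cyclicLocus : Set (nilpotentCommutator B) :=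
  {A | ∃ v, IsCyclicVector (pairAlgebra A.1 B) v}

/-- The matrices `A` in the nilpotent commutator such that `(Aᵀ, Bᵀ)` has a cyclic vector. -/
def cocyclicLocus : Set (nilpotentCommutator B) :=
  {A | ∃ w, IsCyclicVector (pairAlgebra A.1ᵀ Bᵀ) w}

theorem isOpen_cyclicLocus : IsOpen (cyclicLocus B) := by
  let _ := matrixZariskiTopology F n
  refine isOpen_induced_iff.2
    ⟨_, isOpen_exists_span_eq_top (Matrix.mvPolynomialX (Fin n) (Fin n) F) B, ?_⟩
  ext A
  simp only [Set.mem_preimage, Set.mem_ofPred_eq, cyclicLocus,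
    Matrix.mvPolynomialX_mapMatrix_eval]
  exact exists_congr fun v => (isCyclicVector_iff_span A.2.2 v).symm

theorem isOpen_cocyclicLocus : IsOpen (cocyclicLocus B) := by
  let _ := matrixZariskiTopology F n
  refine isOpen_induced_iff.2
    ⟨_, isOpen_exists_span_eq_top (Matrix.mvPolynomialX (Fin n) (Fin n) F)ᵀ Bᵀ, ?_⟩
  ext A
  simp only [Set.mem_preimage, Set.mem_ofPred_eq, cocyclicLocus]
  refine exists_congr fun w => ?_
  rw [isCyclicVector_iff_span (transpose_mul_comm A.2.2) w, RingHom.mapMatrix_apply,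
    Matrix.transpose_map, ← RingHom.mapMatrix_apply, Matrix.mvPolynomialX_mapMatrix_eval]

variable {B}

/-- On a line, a polynomial in the entries becomes one in `t`, with finitely many roots unless it is
zero. -/
theorem continuous_line {P Q : Matrix (Fin n) (Fin n) F}
    (h : ∀ t : F, P + t • (Q - P) ∈ nilpotentCommutator B) :
    Continuous fun t : CofiniteTopology F =>
      (⟨P + CofiniteTopology.of.symm t • (Q - P), h _⟩ : nilpotentCommutator B) := by
  refine continuous_induced_rng.2 (continuous_generateFrom_iff.2 ?_)
  rintro _ ⟨p, rfl⟩
  rw [CofiniteTopology.isOpen_iff]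
  rintro ⟨t₀, ht₀⟩
  let q : Polynomial F := MvPolynomial.eval₂Hom Polynomial.C
    (fun ij => Polynomial.C (P ij.1 ij.2) + Polynomial.X * Polynomial.C ((Q - P) ij.1 ij.2)) p
  have hq : ∀ t : F, q.eval t = evalEntries (P + t • (Q - P)) p := by
    intro t
    have : (Polynomial.evalRingHom t).comp (MvPolynomial.eval₂Hom Polynomial.C
        (fun ij => Polynomial.C (P ij.1 ij.2) + Polynomial.X * Polynomial.C ((Q - P) ij.1 ij.2))) =
        evalEntries (P + t • (Q - P)) := by
      refine MvPolynomial.ringHom_ext (fun a => ?_) fun k => ?_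
      · simp [evalEntries]
      · simp [evalEntries]
    exact congrArg (fun φ => φ p) this
  have hq0 : q ≠ 0 := by
    intro h0
    refine ht₀ ?_
    have := hq (CofiniteTopology.of.symm t₀)
    rw [h0, Polynomial.eval_zero] at this
    exact this.symm
  refine ((q.rootSet_finite F).preimage CofiniteTopology.of.symm.injective.injOn).subset
    fun t ht => ?_
  rw [Set.mem_preimage, Polynomial.mem_rootSet]
  refine ⟨hq0, ?_⟩
  have ht' : evalEntries (P + CofiniteTopology.of.symm t • (Q - P)) p = 0 := by
    by_contra hne
    exact ht hne
  rw [← hq] at ht'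
  simpa using ht'

theorem exists_mem_inter_of_line [Infinite F] {P Q : Matrix (Fin n) (Fin n) F}
    (h : ∀ t : F, P + t • (Q - P) ∈ nilpotentCommutator B) {U V : Set (nilpotentCommutator B)}
    (hU : IsOpen U) (hV : IsOpen V) (hP : ∃ hP : P ∈ nilpotentCommutator B, ⟨P, hP⟩ ∈ U)
    (hQ : ∃ hQ : Q ∈ nilpotentCommutator B, ⟨Q, hQ⟩ ∈ V) :
    ∃ t : F, ⟨P + t • (Q - P), h t⟩ ∈ U ∩ V := by
  have hU' := CofiniteTopology.isOpen_iff.1 (hU.preimage (continuous_line h))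
  have hV' := CofiniteTopology.isOpen_iff.1 (hV.preimage (continuous_line h))
  obtain ⟨hP, hPU⟩ := hP
  obtain ⟨hQ, hQV⟩ := hQ
  have hU'' := hU' ⟨CofiniteTopology.of 0, by
    simpa only [Set.mem_preimage, Equiv.symm_apply_apply, zero_smul, add_zero] using hPU⟩
  have hV'' := hV' ⟨CofiniteTopology.of 1, by
    simpa only [Set.mem_preimage, Equiv.symm_apply_apply, one_smul, add_sub_cancel] using hQV⟩
  have : Infinite (CofiniteTopology F) := CofiniteTopology.of.infinite_iff.1 ‹Infinite F›
  obtain ⟨t, ht⟩ := (hU''.union hV'').infinite_compl.nonempty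
  rw [← Set.compl_inter, compl_compl] at ht
  exact ⟨CofiniteTopology.of.symm t, ht⟩

theorem exists_cyclic_cocyclic_line (hn : 0 < n) (hB : IsNilpotent B)
    (A : nilpotentCommutator B) :
    ∃ P Q : Matrix (Fin n) (Fin n) F,
      (∀ a b c : F, a • A.1 + b • P + c • Q ∈ nilpotentCommutator B) ∧
      (∃ hP : P ∈ nilpotentCommutator B, ⟨P, hP⟩ ∈ cyclicLocus B) ∧
      ∃ hQ : Q ∈ nilpotentCommutator B, ⟨Q, hQ⟩ ∈ cocyclicLocus B := by
  have : NeZero n := ⟨hn.ne'⟩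
  let Φ : Matrix (Fin n) (Fin n) F ≃ₐ[F] Module.End F (Fin n → F) := Matrix.toLinAlgEquiv'
  obtain ⟨T₁, T₂, h₁, h₂, hnil, ⟨v, hv⟩, w, hw⟩ :=
    exists_cyclic_cocyclic (hB.map Φ) (A.2.1.map Φ) (show Commute (Φ A.1) (Φ B) from
      (show Commute A.1 B from A.2.2).map Φ)
  obtain ⟨P, rfl⟩ := Φ.surjective T₁
  obtain ⟨Q, rfl⟩ := Φ.surjective T₂
  have hPB : P * B = B * P := Φ.injective (by rw [map_mul, map_mul]; exact h₁.eq)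
  have hQB : Q * B = B * Q := Φ.injective (by rw [map_mul, map_mul]; exact h₂.eq)
  have hmem : ∀ a b c : F, a • A.1 + b • P + c • Q ∈ nilpotentCommutator B := by
    intro a b c
    constructor
    · have := (hnil a b c).map Φ.symm
      simpa using this
    · simp only [add_mul, mul_add, smul_mul_assoc, mul_smul_comm, A.2.2, hPB, hQB]
  have hΦ : ∀ (X Y : Matrix (Fin n) (Fin n) F) (i j : ℕ) (u : Fin n → F),
      (Φ X ^ i) ((Φ Y ^ j) u) = (X ^ i * Y ^ j) *ᵥ u := by
    intro X Y i j u
    rw [← map_pow, ← map_pow, ← mulVec_mulVec]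
    rfl
  refine ⟨P, Q, hmem, ⟨by simpa using hmem 0 1 0, v, ?_⟩, by simpa using hmem 0 0 1, ?_⟩
  · rw [isCyclicVector_iff_span hPB]
    simpa only [hΦ] using hv
  · obtain ⟨w, rfl⟩ := (dotProductEquiv F (Fin n)).surjective w
    refine ⟨w, ?_⟩
    rw [isCyclicVector_iff_span (transpose_mul_comm hQB)]
    -- Were the span proper, a nonzero `u` would be orthogonal to it, and `hw` would force `u = 0`.
    by_contra hne
    obtain ⟨f, hf0, hf⟩ := Submodule.exists_le_ker_of_lt_top _
      (lt_top_iff_ne_top.2 fun h => hne h.ge)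
    obtain ⟨u, rfl⟩ := (dotProductEquiv F (Fin n)).surjective f
    refine hf0 ?_
    rw [hw u fun i j => ?_, map_zero]
    have h3 : u ⬝ᵥ ((Qᵀ ^ i * Bᵀ ^ j) *ᵥ w) = 0 := hf (Submodule.subset_span ⟨(i, j), rfl⟩)
    rw [hΦ]
    change w ⬝ᵥ ((Q ^ i * B ^ j) *ᵥ u) = 0
    have h4 : Qᵀ ^ i * Bᵀ ^ j = (Q ^ i * B ^ j)ᵀ := by
      rw [transpose_mul, transpose_pow, transpose_pow]
      exact (Commute.pow_pow (transpose_mul_comm hQB) i j).eq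
    rw [h4, mulVec_transpose, dotProduct_comm, ← dotProduct_mulVec] at h3
    exact h3

theorem dense_cyclicLocus_inter [Infinite F] (hn : 0 < n) (hB : IsNilpotent B) :
    Dense (cyclicLocus B ∩ cocyclicLocus B) := by
  rw [dense_iff_inter_open]
  rintro U hU ⟨A, hA⟩
  obtain ⟨P, Q, hmem, hP, hQ⟩ := exists_cyclic_cocyclic_line hn hB A
  obtain ⟨t, ht⟩ := exists_mem_inter_of_line (P := P) (Q := Q)
    (fun t => by
      have := hmem 0 (1 - t) t
      rw [zero_smul, zero_add, sub_smul, one_smul] at this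
      convert! this using 1
      rw [smul_sub]
      abel) (isOpen_cyclicLocus B) (isOpen_cocyclicLocus B) hP hQ
  -- The second line joins `A` to the good point just found and stays in the span of `A`, `P`, `Q`.
  obtain ⟨s, hs⟩ := exists_mem_inter_of_line (P := A.1) (Q := P + t • (Q - P))
    (fun s => by
      convert! hmem (1 - s) (s * (1 - t)) (s * t) using 1
      module) hU ((isOpen_cyclicLocus B).inter (isOpen_cocyclicLocus B)) ⟨A.2, hA⟩ ⟨_, ht⟩
  exact ⟨_, hs⟩

end nilpotentCommutator

theorem cyclicCocyclicLocus_eq_inter (B : Matrix (Fin n) (Fin n) F) :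
    cyclicCocyclicLocus B =
      nilpotentCommutator.cyclicLocus B ∩ nilpotentCommutator.cocyclicLocus B := by
  ext A
  constructor
  · rintro ⟨⟨A, v, w⟩, ⟨hv, hw⟩, rfl⟩
    exact ⟨⟨v, hv⟩, w, hw⟩
  · rintro ⟨⟨v, hv⟩, w, hw⟩
    exact ⟨(A, v, w), ⟨hv, hw⟩, rfl⟩

end Zariski

/-! ### The theorem -/

theorem corollary2p5 {F : Type u} [Field F] [IsAlgClosed F] (n : ℕ) (hn : 0 < n)
    (B : Matrix (Fin n) (Fin n) F) (hB : IsNilpotent B) :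
    Dense (cyclicCocyclicLocus B) ∧
    (∀ A : nilpotentCommutator B,
      (A ∈ cyclicCocyclicLocus B ↔
        IsArtinianGorenstein (pairAlgebra A.1 B) ∧ Module.finrank F (pairAlgebra A.1 B) = n) ∧
      ((IsArtinianGorenstein (pairAlgebra A.1 B) ∧ Module.finrank F (pairAlgebra A.1 B) = n) ↔
        (∃ v, IsCyclicVector (pairAlgebra A.1 B) v) ∧
          ∃ w, IsCyclicVector (pairAlgebra A.1.transpose B.transpose) w) ∧
      (A ∈ cyclicCocyclicLocus B → IsArtinianCompleteIntersection (pairAlgebra A.1 B))) ∧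
    HoldsGenerically (fun A : nilpotentCommutator B =>
      IsArtinianGorenstein (pairAlgebra A.1 B) ∧ Module.finrank F (pairAlgebra A.1 B) = n ∧
        IsArtinianCompleteIntersection (pairAlgebra A.1 B)) := by
  -- Algebraic closedness enters only through the infinitude of `F`.
  have : Infinite F := IsAlgClosed.instInfinite
  have hdense := nilpotentCommutator.dense_cyclicLocus_inter hn hB
  have hG : ∀ A : nilpotentCommutator B,
      (∃ v, IsCyclicVector (pairAlgebra A.1 B) v) ∧
        (∃ w, IsCyclicVector (pairAlgebra A.1.transpose B.transpose) w) ↔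
      IsArtinianGorenstein (pairAlgebra A.1 B) ∧ Module.finrank F (pairAlgebra A.1 B) = n :=
    fun A => ⟨fun ⟨⟨_, hv⟩, _, hw⟩ => ⟨nilpotentCommutator.isArtinianGorenstein A hn hB hv hw,
      nilpotentCommutator.finrank_eq_of_isCyclicVector A hv⟩,
      fun ⟨h₁, h₂⟩ => nilpotentCommutator.exists_isCyclicVector A hB h₁ h₂⟩
  have hCI : ∀ A ∈ nilpotentCommutator.cyclicLocus B ∩ nilpotentCommutator.cocyclicLocus B,
      IsArtinianCompleteIntersection (pairAlgebra A.1 B) := fun A ⟨⟨_, hv⟩, _, hw⟩ =>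
    nilpotentCommutator.isArtinianCompleteIntersection A hn hB hv hw
  rw [cyclicCocyclicLocus_eq_inter]
  refine ⟨hdense, fun A => ⟨hG A, (hG A).symm, hCI A⟩, _,
    (nilpotentCommutator.isOpen_cyclicLocus B).inter (nilpotentCommutator.isOpen_cocyclicLocus B),
    hdense, fun A hA => ?_⟩
  obtain ⟨h₁, h₂⟩ := (hG A).1 hA
  exact ⟨h₁, h₂, hCI A hA⟩
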